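/- Setting. Let $G=(V,\omega)$ be a finite connected simple undirected weighted graph: $\omega_{ij}=\omega_{ji}\ge 0$, $\omega_{ii}=0$, with $ij$ an edge if and only if $\omega_{ij}>0$. Let $d_i=\sum_j\omega_{ij}$, $r\in[0,1]$, $\mathcal V=\mathbb R^V$, and let $\mathcal V_{[0,1]}$ be the set of $u\in\mathcal V$ with values in $[0,1]$. Let $(\Delta u)_i=d_i^{-r}\sum_j\omega_{ij}(u_i-u_j)$. Let $\mu\in\mathcal V$ with $\mu\ge 0$, $\mu\ne 0$, let $\tilde f\in\mathcal V_{[0,1]}$, and put $M=\operatorname{diag}(\mu)$, $A=\Delta+M$, $f=M\tilde f$, and $\mathcal S_t u=e^{-tA}u+A^{-1}(I-e^{-tA})f$. For $u\in\mathcal V$ let $\mathcal B(u)$ be empty if $u\notin\mathcal V_{[0,1]}$, and otherwise the set of $\beta\in\mathcal V$ such that for every $i$: $\beta_i\ge 0$ if $u_i=0$, $\beta_i=0$ if $0<u_i<1$, and $\beta_i\le 0$ if $u_i=1$. Fix $\varepsilon>0$ with $\varepsilon^{-1}$ not an eigenvalue of $A$, and $u_0\in\mathcal V_{[0,1]}$.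 For $0<\tau<\varepsilon$ and $\lambda=\tau/\varepsilon$, the SDIE iterates $u^{[\tau]}_m$ ($m\ge 0$), $\beta^{[\tau]}_m$ ($m\ge 1$) with initial state $u^{[\tau]}_0=u_0$ are given by $$(1-\lambda)u^{[\tau]}_{m+1}-\mathcal S_\tau u^{[\tau]}_m+\tfrac{\lambda}{2}\mathbf 1=\lambda\beta^{[\tau]}_{m+1},\qquad \beta^{[\tau]}_{m+1}\in\mathcal B(u^{[\tau]}_{m+1})\qquad(m\ge 0).$$ A solution of the double-obstacle Allen–Cahn equation (ACE) with fidelity forcing on $[0,\infty)$ is a pair $(u,\beta)$ with $u:[0,\infty)\to\mathcal V_{[0,1]}$ continuous and in $H^1_{loc}([0,\infty);\mathcal V)$ (that is, in $H^1((a,b);\mathcal V)$ for all $a,b\in[0,\infty)$), $\beta:[0,\infty)\to\mathcal V$, and, for a.e. $t\ge 0$, $$\varepsilon\frac{du}{dt}(t)+\varepsilon Au(t)-\varepsilon f+\tfrac12\mathbf 1-u(t)=\beta(t),\qquad \beta(t)\in\mathcal B(u(t)).$$ Theorem. For every $0<\tau<\varepsilon$ the SDIE iterates with initial state $u_0$ exist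 and are unique. There is a solution $(\hat u,\gamma)$ of the double-obstacle ACE with fidelity forcing on $[0,\infty)$ with $\hat u(0)=u_0$; it is unique, in the sense that any other such solution $(v,\zeta)$ has $v(t)=\hat u(t)$ for all $t\ge 0$ and $\zeta(t)=\gamma(t)$ for a.e. $t\ge 0$. Moreover: 1. For every sequence $\tau_n>0$ with $\tau_n\to 0$ there is a subsequence $\tau'_n$ of $\tau_n$, with $\tau'_n<\varepsilon$ for all $n$, such that for each $t\ge 0$, $u^{[\tau'_n]}_{\lceil t/\tau'_n\rceil}\to\hat u(t)$ as $n\to\infty$, and there is a sequence of integers $N_k\to\infty$, independent of $t$, such that for a.e. $t\ge 0$, $\frac1{N_k}\sum_{n=1}^{N_k}\beta^{[\tau'_n]}_{\lceil t/\tau'_n\rceil}\to\gamma(t)$ as $k\to\infty$. 2. For every sequence $\tau_n\to 0$ with $0<\tau_n<\varepsilon$ for all $n$, and each $t\ge 0$, $u^{[\tau_n]}_{\lceil t/\tau_n\rceil}\to\hat u(t)$ as $n\to\infty$. -/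

import Mathlib

open MeasureTheory Filter Topology
open scoped Matrix ContDiff

noncomputable section

namespace GraphACE

/-- A finite, simple, undirected, connected, weighted graph without self-loops on the vertex set
`V`; `ij` is an edge exactly when its weight is positive. -/
structure WeightedGraph (V : Type*) where
  weight : V → V → ℝ
  weight_nonneg : ∀ i j, 0 ≤ weight i j
  weight_symm : ∀ i j, weight i j = weight j i
  weight_self : ∀ i, weight i i = 0
  connected : (SimpleGraph.fromRel fun i j => 0 < weight i j).Connected

variable {V : Type*} [Fintype V] [DecidableEq V]

/-- The degree `d_i = ∑_j ω_ij`. -/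
def WeightedGraph.degree (G : WeightedGraph V) (i : V) : ℝ := ∑ j, G.weight i j

/-- The graph Laplacian `Δ = D^{-r} (D - ω)`,
that is `(Δ u)_i = d_i^{-r} ∑_j ω_ij (u_i - u_j)`. -/
def WeightedGraph.laplacian (G : WeightedGraph V) (r : ℝ) : Matrix V V ℝ :=
  Matrix.diagonal (fun i => G.degree i ^ (-r)) *
    (Matrix.diagonal G.degree - Matrix.of G.weight)

/-- The operator `A = Δ + M` with `M = diag(μ)`. -/
def forcedLaplacian (G : WeightedGraph V) (r : ℝ) (μ : V → ℝ) : Matrix V V ℝ :=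
  G.laplacian r + Matrix.diagonal μ

/-- The forcing term `f = M f̃`. -/
def forcing (μ ftilde : V → ℝ) : V → ℝ := Matrix.diagonal μ *ᵥ ftilde

/-- The fidelity forced diffusion `S_t u = e^{-tA} u + A⁻¹ (I - e^{-tA}) f`: the solution at time
`t` of `dv/dt = -A v + f`, `v(0) = u`. -/
def diffusion (A : Matrix V V ℝ) (f : V → ℝ) (t : ℝ) (u : V → ℝ) : V → ℝ :=
  NormedSpace.exp (-(t • A)) *ᵥ u + (A⁻¹ * (1 - NormedSpace.exp (-(t • A)))) *ᵥ f

/-- The set `𝓑(u)` of all `α` with `α_i ∈ -∂I_{[0,1]}(u_i)` for every vertex `i`, where `I_{[0,1]}`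
is the convex indicator function of `[0,1]`. It is empty unless `u` takes its values in `[0,1]`. -/
def obstacleSet {V : Type*} (u : V → ℝ) : Set (V → ℝ) :=
  {α | ∀ i, u i ∈ Set.Icc (0 : ℝ) 1 ∧
    (u i = 0 → 0 ≤ α i) ∧ (0 < u i → u i < 1 → α i = 0) ∧ (u i = 1 → α i ≤ 0)}

/-- `(u_m, β_m)` are SDIE iterates with time step `τ` and initial state `u₀`: with `λ = τ / ε`,
`(1 - λ) u_{m+1} - S_τ u_m + (λ / 2) 𝟏 = λ β_{m+1}` and `β_{m+1} ∈ 𝓑(u_{m+1})` for all `m`.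
The value `β 0` is unused. -/
structure IsSDIE (A : Matrix V V ℝ) (f : V → ℝ) (ε τ : ℝ) (u₀ : V → ℝ)
    (u β : ℕ → V → ℝ) : Prop where
  init : u 0 = u₀
  step : ∀ m i, (1 - τ / ε) * u (m + 1) i - diffusion A f τ (u m) i + (τ / ε) / 2
    = (τ / ε) * β (m + 1) i
  mem : ∀ m, β (m + 1) ∈ obstacleSet (u (m + 1))

/-- `u` belongs to `H¹((a,b); 𝓥)` with weak derivative `g`, for `𝓥 = (V → ℝ)`. Scalar test functions
tested against every component are the same as `𝓥`-valued test functions. -/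
structure HasWeakDerivL2 {V : Type*} [Fintype V] (a b : ℝ) (u g : ℝ → V → ℝ) : Prop where
  memLp : MemLp u 2 (volume.restrict (Set.Ioo a b))
  memLp_deriv : MemLp g 2 (volume.restrict (Set.Ioo a b))
  weak : ∀ φ : ℝ → ℝ, ContDiff ℝ ∞ φ → HasCompactSupport φ → tsupport φ ⊆ Set.Ioo a b →
    ∀ i, ∫ t in Set.Ioo a b, u t i * deriv φ t = -∫ t in Set.Ioo a b, g t i * φ t

/-- `(u, β)` solves the double-obstacle Allen–Cahn equation with fidelity forcing on the
interval `T`: `u` is `[0,1]`-valued, continuous and in `H¹_loc(T; 𝓥)`, with weak derivative `du/dt`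
such that, at almost every `t ∈ T`,
`ε du/dt + ε A u - ε f + 𝟏/2 - u = β` and `β ∈ 𝓑(u)`. -/
structure IsACESolution {V : Type*} [Fintype V] (A : Matrix V V ℝ) (f : V → ℝ) (ε : ℝ) (T : Set ℝ)
    (u β : ℝ → V → ℝ) : Prop where
  mem_Icc : ∀ t ∈ T, ∀ i, u t i ∈ Set.Icc (0 : ℝ) 1
  continuousOn : ContinuousOn u T
  equation : ∃ u' : ℝ → V → ℝ, (∀ a ∈ T, ∀ b ∈ T, HasWeakDerivL2 a b u u') ∧
    ∀ᵐ t ∂(volume.restrict T),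
      (∀ i, ε * u' t i + ε * (A *ᵥ u t) i - ε * f i + 1 / 2 - u t i = β t i) ∧
      β t ∈ obstacleSet (u t)

end GraphACE

end

/-! Put `G(v) = f - Av + v/ε - 1/(2ε)` and `b = β/ε`. The equation becomes the differential
inclusion `u' ∈ G(u) + 𝓑(u)`, with `G` Lipschitz and `-𝓑` monotone. Expanding `S_τ` to second order
turns an SDIE step into `u_{m+1} = u_m + τ(G(u_m) + b_{m+1}) + O(τ²)`: Euler, explicit in `G` and
implicit in the obstacle, with increments of order `τ` and bounded `b`
(`exists_isObstacleScheme_of_isSDIE`). This abstract scheme is all that the convergence argument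
sees.

Let `w` be the difference of the piecewise linear interpolants of two schemes with steps `τ`, `σ`
and the same initial state. Monotonicity gives `⟨w, w'⟩ ≤ K|w|² + c(τ + σ)`, and Grönwall gives
`|w|² ≤ D(τ + σ)` on bounded intervals (`sum_sq_interpolant_sub_le`). Hence the interpolants are
Cauchy as the step tends to `0`, without any compactness: the limit is the same for every sequence
of steps, and it is Lipschitz, hence differentiable almost everywhere.

The multipliers converge too, at every positive time of differentiability, to `uhat' - G(uhat)`
(`tendsto_multiplier`). Strictly between the obstacles they are eventually zero. On an obstacle the
limit has an extremum, so its velocity vanishes; if the field points strictly outwards there, the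
discrete trajectory reached the obstacle a little earlier and stays on it, and the step equation
then yields the multiplier. So the subsequence of the theorem can be a tail, and the Cesàro means
are those of a convergent sequence. That the limit solves the equation follows from one-sided bounds
on its derivative; uniqueness is the same monotonicity and Grönwall argument. -/

namespace GraphACE

/-! ### Grönwall, energy estimates and weak derivatives on the line -/

/-- The integral form of Grönwall's inequality, for a continuous function. -/
theorem le_mul_exp_of_le_integral {φ : ℝ → ℝ} {T K c : ℝ} (hK : 0 ≤ K)
    (hφ : ContinuousOn φ (Set.Icc 0 T))
    (h : ∀ t ∈ Set.Icc 0 T, φ t ≤ c + K * ∫ s in (0:ℝ)..t, φ s) :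
    ∀ t ∈ Set.Icc 0 T, φ t ≤ c * Real.exp (K * t) := by
  intro t ht
  have hT : 0 ≤ T := ht.1.trans ht.2
  -- The extension is continuous on all of `ℝ`, so its primitive is differentiable at the endpoints
  -- too and the differential Grönwall bound applies to it.
  set χ : ℝ → ℝ := Set.IccExtend hT ((Set.Icc 0 T).domRestrict φ) with hχ
  have hχc : Continuous χ := (continuousOn_iff_continuous_domRestrict.1 hφ).Icc_extend'
  have hχe : ∀ s ∈ Set.Icc 0 T, χ s = φ s := fun s hs => by
    rw [hχ, Set.IccExtend_of_mem hT _ hs]; rfl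
  have hint : ∀ s ∈ Set.Icc 0 T, ∫ r in (0:ℝ)..s, φ r = ∫ r in (0:ℝ)..s, χ r := fun s hs => by
    refine intervalIntegral.integral_congr fun r hr => ?_
    rw [Set.uIcc_of_le hs.1] at hr
    exact (hχe r ⟨hr.1, hr.2.trans hs.2⟩).symm
  set ψ : ℝ → ℝ := fun s => c + K * ∫ r in (0:ℝ)..s, χ r with hψ
  have hψd : ∀ s, HasDerivAt ψ (K * χ s) s := fun s =>
    ((hχc.integral_hasStrictDerivAt 0 s).hasDerivAt.const_mul K).const_add c
  have key := le_gronwallBound_of_liminf_deriv_right_le (f := ψ) (f' := fun s => K * χ s)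
    (δ := c) (K := K) (ε := 0) (a := 0) (b := T)
    (fun s _ => (hψd s).continuousAt.continuousWithinAt)
    (fun s _ r hr => (hψd s).hasDerivWithinAt.liminf_right_slope_le hr)
    (by simp [hψ])
    (fun s hs => by
      have hs' : s ∈ Set.Icc 0 T := ⟨hs.1, hs.2.le⟩
      have := h s hs'
      rw [hint s hs', ← hχe s hs'] at this
      simpa using mul_le_mul_of_nonneg_left this hK) t ht
  rw [gronwallBound_ε0, sub_zero] at key
  refine le_trans ?_ key
  have := h t ht
  rwa [hint t ht] at this

/-- The square of an indefinite integral. -/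
theorem sq_integral_eq {q : ℝ → ℝ} {T : ℝ} (hq : IntervalIntegrable q volume 0 T) :
    (∫ s in (0:ℝ)..T, q s) ^ 2 = ∫ s in (0:ℝ)..T, 2 * ((∫ r in (0:ℝ)..s, q r) * q s) := by
  have hac := hq.absolutelyContinuousOnInterval_intervalIntegral (c := 0) (by simp)
  have h := hac.integral_deriv_mul_eq_sub hac
  simp only [intervalIntegral.integral_same, mul_zero, sub_zero] at h
  rw [sq, ← h]
  refine intervalIntegral.integral_congr_ae ?_
  filter_upwards [hq.ae_hasDerivAt_integral] with s hs hs'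
  rw [(hs (Set.uIoc_subset_uIcc hs') 0 (by simp)).deriv]
  ring

/-- Energy estimate: `w` vanishes at `0` and has derivative `q`, with `⟨w, q⟩ ≤ K |w|² + c`. -/
theorem sum_sq_le_of_inner_deriv_le {V : Type*} [Fintype V] {w q : ℝ → V → ℝ} {T K c : ℝ}
    (hK : 0 ≤ K) (hc : 0 ≤ c)
    (hq : ∀ i, IntervalIntegrable (fun s => q s i) volume 0 T)
    (hw : ∀ t ∈ Set.Icc 0 T, ∀ i, w t i = ∫ s in (0:ℝ)..t, q s i)
    (h : ∀ᵐ s, s ∈ Set.Ioc 0 T → ∑ i, w s i * q s i ≤ K * ∑ i, w s i ^ 2 + c) :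
    ∀ t ∈ Set.Icc 0 T, ∑ i, w t i ^ 2 ≤ 2 * c * T * Real.exp (2 * K * T) := by
  intro t ht
  have hT : 0 ≤ T := ht.1.trans ht.2
  have hwc : ∀ i, ContinuousOn (fun s => w s i) (Set.Icc 0 T) := fun i => by
    have := intervalIntegral.continuousOn_primitive_interval' (hq i) (a := 0) (by simp)
    rw [Set.uIcc_of_le hT] at this
    exact this.congr fun s hs => hw s hs i
  have hφc : ContinuousOn (fun s => ∑ i, w s i ^ 2) (Set.Icc 0 T) :=
    continuousOn_finsetSum _ fun i _ => (hwc i).pow 2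
  have key := le_mul_exp_of_le_integral (φ := fun s => ∑ i, w s i ^ 2) (T := T) (K := 2 * K)
    (c := 2 * c * T) (by positivity) hφc (fun s hs => ?_) t ht
  · refine key.trans ?_
    gcongr
    exact ht.2
  have hsub : Set.uIcc 0 s ⊆ Set.uIcc 0 T := by
    rw [Set.uIcc_of_le hs.1, Set.uIcc_of_le hT]; exact Set.Icc_subset_Icc_right hs.2
  have hq' : ∀ i, IntervalIntegrable (fun s => q s i) volume 0 s := fun i => (hq i).mono_set hsub
  have hwc' : ∀ i, ContinuousOn (fun s => w s i) (Set.uIcc 0 s) := fun i => by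
    refine (hwc i).mono ?_
    rw [Set.uIcc_of_le hs.1]; exact Set.Icc_subset_Icc_right hs.2
  have hwq : ∀ i, IntervalIntegrable (fun r => 2 * (w r i * q r i)) volume 0 s := fun i =>
    ((hq' i).continuousOn_mul (hwc' i)).const_mul 2
  have hφi : IntervalIntegrable (fun r => ∑ i, w r i ^ 2) volume 0 s :=
    ContinuousOn.intervalIntegrable (continuousOn_finsetSum _ fun i _ => (hwc' i).pow 2)
  calc ∑ i, w s i ^ 2 = ∑ i, ∫ r in (0:ℝ)..s, 2 * (w r i * q r i) := by
        refine Finset.sum_congr rfl fun i _ => ?_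
        rw [hw s hs i, sq_integral_eq (hq' i)]
        refine intervalIntegral.integral_congr fun r hr => ?_
        rw [Set.uIcc_of_le hs.1] at hr
        simp only [hw r ⟨hr.1, hr.2.trans hs.2⟩ i]
    _ = ∫ r in (0:ℝ)..s, ∑ i, 2 * (w r i * q r i) :=
        (intervalIntegral.integral_finsetSum fun i _ => hwq i).symm
    _ ≤ ∫ r in (0:ℝ)..s, (2 * K * (∑ i, w r i ^ 2) + 2 * c) := by
        refine intervalIntegral.integral_mono_ae_restrict hs.1
          (by simpa [Finset.sum_fn] using IntervalIntegrable.sum Finset.univ (fun i _ => hwq i))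
          ((hφi.const_mul _).add intervalIntegrable_const) ?_
        rw [Filter.EventuallyLE, ← restrict_Ioc_eq_restrict_Icc,
          ae_restrict_iff' measurableSet_Ioc]
        filter_upwards [h] with r hr hr'
        have := hr ⟨hr'.1, hr'.2.trans hs.2⟩
        rw [← Finset.mul_sum]
        linarith
    _ = 2 * c * s + 2 * K * ∫ r in (0:ℝ)..s, ∑ i, w r i ^ 2 := by
        rw [intervalIntegral.integral_add (hφi.const_mul _) intervalIntegrable_const,
          intervalIntegral.integral_const_mul, intervalIntegral.integral_const]
        simp; ring
    _ ≤ 2 * c * T + 2 * K * ∫ r in (0:ℝ)..s, ∑ i, w r i ^ 2 := by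
        have := hs.2
        gcongr

/-- du Bois-Reymond: a continuous function with vanishing weak derivative is constant. -/
theorem eq_of_forall_integral_mul_deriv_eq_zero {h : ℝ → ℝ} {a b : ℝ}
    (hh : ContinuousOn h (Set.Ioo a b))
    (H : ∀ φ : ℝ → ℝ, ContDiff ℝ ∞ φ → HasCompactSupport φ → tsupport φ ⊆ Set.Ioo a b →
      ∫ t in Set.Ioo a b, h t * deriv φ t = 0) :
    ∃ c, ∀ t ∈ Set.Ioo a b, h t = c := by
  rcases le_or_gt b a with hab | hab
  · exact ⟨0, fun t ht => absurd (ht.1.trans ht.2) (not_lt.2 hab)⟩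
  have hloc : LocallyIntegrableOn h (Set.Ioo a b) :=
    hh.locallyIntegrableOn measurableSet_Ioo
  have hint : ∀ ψ : ℝ → ℝ, Continuous ψ → HasCompactSupport ψ → tsupport ψ ⊆ Set.Ioo a b →
      IntegrableOn (fun t => h t * ψ t) (Set.Ioo a b) := by
    intro ψ hψ hψc hψs
    have h1 : IntegrableOn (fun t => h t * ψ t) (tsupport ψ) :=
      ((hh.mono hψs).mul hψ.continuousOn).integrableOn_compact hψc
    refine h1.of_forall_sdiff_eq_zero (μ := volume) measurableSet_Ioo fun t ht => ?_
    rw [image_eq_zero_of_notMem_tsupport ht.2, mul_zero]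
  -- A test function of mean zero is the derivative of a test function, namely of its primitive from
  -- `a`: the vanishing mean makes that primitive compactly supported.
  have hmean : ∀ ψ : ℝ → ℝ, ContDiff ℝ ∞ ψ → HasCompactSupport ψ → tsupport ψ ⊆ Set.Ioo a b →
      ∫ t, ψ t = 0 → ∫ t in Set.Ioo a b, h t * ψ t = 0 := by
    intro ψ hψ hψc hψs hψ0
    have hψcont : Continuous ψ := hψ.continuous
    set φ : ℝ → ℝ := fun t => ∫ s in a..t, ψ s with hφ
    have hφd : ∀ t, HasDerivAt φ (ψ t) t := fun t =>
      (hψcont.integral_hasStrictDerivAt a t).hasDerivAt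
    have hderiv : deriv φ = ψ := funext fun t => (hφd t).deriv
    have hφs : ContDiff ℝ ∞ φ := by
      rw [contDiff_infty_iff_deriv]
      exact ⟨fun t => (hφd t).differentiableAt, hderiv ▸ hψ⟩
    rcases (tsupport ψ).eq_empty_or_nonempty with he | hne
    · have : ψ = 0 := tsupport_eq_empty_iff.1 he
      simp [this]
    obtain ⟨l, hl, hl'⟩ := hψc.isCompact.exists_isLeast hne
    obtain ⟨u, hu, hu'⟩ := hψc.isCompact.exists_isGreatest hne
    have hzero : ∀ t, t ∉ Set.Icc l u → φ t = 0 := by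
      intro t ht
      have hz : ∀ s, s ∉ Set.Icc l u → ψ s = 0 := fun s hs =>
        image_eq_zero_of_notMem_tsupport fun hs' => hs ⟨hl' hs', hu' hs'⟩
      rw [Set.mem_Icc, not_and_or, not_le, not_le] at ht
      have hal := (hψs hl).1
      rcases ht with ht | ht
      · refine intervalIntegral.integral_zero_ae (Eventually.of_forall fun s hs => hz s ?_)
        intro hs'
        have : s ≤ max a t := hs.2
        exact absurd (hs'.1.trans this) (not_le.2 (max_lt hal ht))
      · have hlu : l ≤ u := hl' hu
        rw [hφ, ← hψ0]
        simp only
        rw [intervalIntegral.integral_of_le (by linarith)]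
        refine setIntegral_eq_integral_of_forall_compl_eq_zero fun s hs => hz s fun hs' => hs ?_
        exact ⟨lt_of_lt_of_le hal hs'.1, hs'.2.trans ht.le⟩
    have hsub : tsupport φ ⊆ Set.Icc l u :=
      closure_minimal (fun t ht => by_contra fun h' => ht (hzero t h')) isClosed_Icc
    have hφc : HasCompactSupport φ := isCompact_Icc.of_isClosed_subset isClosed_closure hsub
    rw [← hderiv]
    exact H φ hφs hφc (hsub.trans fun s hs => ⟨(hψs hl).1.trans_le hs.1, hs.2.trans_lt (hψs hu).2⟩)
  set x := (a + b) / 2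
  -- Subtracting `(∫ g) η`, with `η` of integral one, makes any test function `g` mean-zero. So `h -
  -- c`, with `c = ∫ h η`, is orthogonal to every `g`.
  let η : ContDiffBump x := ⟨(b - a) / 8, (b - a) / 4, by linarith, by linarith⟩
  have hηs : tsupport (η.normed volume) ⊆ Set.Ioo a b := by
    rw [η.tsupport_normed_eq, Real.closedBall_eq_Icc]
    intro t ht
    have h1 : x - (b - a) / 4 ≤ t := ht.1
    have h2 : t ≤ x + (b - a) / 4 := ht.2
    simp only [x] at h1 h2
    constructor <;> linarith
  have hη := η.contDiff_normed (μ := volume) (n := (⊤ : ℕ∞))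
  have hηc : HasCompactSupport (η.normed volume) := η.hasCompactSupport_normed
  set c := ∫ t in Set.Ioo a b, h t * η.normed volume t with hc
  have hae : ∀ᵐ t, t ∈ Set.Ioo a b → h t - c = 0 := by
    refine isOpen_Ioo.ae_eq_zero_of_integral_contDiff_smul_eq_zero
      (hloc.sub ((locallyIntegrable_const c).locallyIntegrableOn _)) ?_
    intro g hg hgc hgs
    have e0 : ∀ ψ : ℝ → ℝ, tsupport ψ ⊆ Set.Ioo a b → ∫ t in Set.Ioo a b, ψ t = ∫ t, ψ t :=
      fun ψ hψ => setIntegral_eq_integral_of_forall_compl_eq_zero fun t ht =>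
        image_eq_zero_of_notMem_tsupport fun h' => ht (hψ h')
    have hgi : Integrable g := hg.continuous.integrable_of_hasCompactSupport hgc
    have e1 : ∫ t, g t • (h t - c) = ∫ t in Set.Ioo a b, (h t * g t - c * g t) := by
      rw [← setIntegral_eq_integral_of_forall_compl_eq_zero (s := Set.Ioo a b)]
      · refine integral_congr_ae (Eventually.of_forall fun t => ?_)
        simp only [smul_eq_mul]; ring
      · intro t ht
        rw [image_eq_zero_of_notMem_tsupport fun h' => ht (hgs h'), zero_smul]
    rw [e1, integral_sub (hint g hg.continuous hgc hgs) (hgi.integrableOn.const_mul c),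
      integral_const_mul, e0 g hgs]
    have hsupp : tsupport (fun t => g t - (∫ s, g s) * η.normed volume t) ⊆
        tsupport g ∪ tsupport (η.normed volume) := by
      refine closure_minimal (fun t ht => ?_)
        ((isClosed_tsupport g).union (isClosed_tsupport (η.normed volume)))
      by_contra hcon
      rw [Set.mem_union, not_or] at hcon
      refine ht ?_
      simp only
      rw [image_eq_zero_of_notMem_tsupport hcon.1, image_eq_zero_of_notMem_tsupport hcon.2]
      ring
    have h2 := hmean (fun t => g t - (∫ s, g s) * η.normed volume t)
      (hg.sub (contDiff_const.mul hη))
      ((hgc.isCompact.union hηc.isCompact).of_isClosed_subset (isClosed_tsupport _) hsupp)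
      (hsupp.trans (Set.union_subset hgs hηs))
      (by
        rw [integral_sub hgi (η.integrable_normed.const_mul _), integral_const_mul,
          η.integral_normed]
        ring)
    have e2 : ∀ t, h t * (g t - (∫ s, g s) * η.normed volume t) =
        h t * g t - (∫ s, g s) * (h t * η.normed volume t) := fun t => by ring
    simp_rw [e2] at h2
    rw [integral_sub (hint g hg.continuous hgc hgs)
      ((hint _ hη.continuous hηc hηs).const_mul _), integral_const_mul, ← hc] at h2
    linarith
  refine ⟨c, fun t ht => ?_⟩
  have hae' : (fun t => h t) =ᵐ[volume.restrict (Set.Ioo a b)] fun _ => c := by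
    rw [Filter.EventuallyEq, ae_restrict_iff' measurableSet_Ioo]
    filter_upwards [hae] with s hs hs'
    linarith [hs hs']
  exact Measure.eqOn_open_of_ae_eq hae' isOpen_Ioo hh continuousOn_const ht

/-- A continuous function with an integrable weak derivative is its indefinite integral. -/
theorem eq_add_integral_of_weak_deriv {u g : ℝ → ℝ} {T : ℝ}
    (hu : ContinuousOn u (Set.Icc 0 T)) (hg : IntervalIntegrable g volume 0 T)
    (H : ∀ φ : ℝ → ℝ, ContDiff ℝ ∞ φ → HasCompactSupport φ → tsupport φ ⊆ Set.Ioo 0 T →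
      ∫ t in Set.Ioo 0 T, u t * deriv φ t = -∫ t in Set.Ioo 0 T, g t * φ t) :
    ∀ t ∈ Set.Icc 0 T, u t = u 0 + ∫ s in (0:ℝ)..t, g s := by
  intro t ht
  have hT : 0 ≤ T := ht.1.trans ht.2
  rcases hT.eq_or_lt with rfl | hT'
  · obtain rfl : t = 0 := le_antisymm ht.2 ht.1
    simp
  have hPac := hg.absolutelyContinuousOnInterval_intervalIntegral (c := 0) (by simp)
  have hPc : ContinuousOn (fun t => ∫ s in (0:ℝ)..t, g s) (Set.Icc 0 T) := by
    have := hPac.continuousOn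
    rwa [Set.uIcc_of_le hT] at this
  have hc : ContinuousOn (fun t => u t - ∫ s in (0:ℝ)..t, g s) (Set.Icc 0 T) := hu.sub hPc
  obtain ⟨c, hcc⟩ := eq_of_forall_integral_mul_deriv_eq_zero (a := 0) (b := T)
    (hc.mono Set.Ioo_subset_Icc_self) (by
      intro φ hφ hφc hφs
      have hφ0 : φ 0 = 0 := image_eq_zero_of_notMem_tsupport fun h' => lt_irrefl _ (hφs h').1
      have hφT : φ T = 0 := image_eq_zero_of_notMem_tsupport fun h' => lt_irrefl _ (hφs h').2
      have hdc : Continuous (deriv φ) := hφ.continuous_deriv (by simp)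
      have hφac : AbsolutelyContinuousOnInterval φ 0 T := by
        obtain ⟨C, hC⟩ := (hφ.of_le (by simp : (1:WithTop ℕ∞) ≤ ∞)).lipschitzWith_of_hasCompactSupport
          hφc (by simp)
        exact (hC.lipschitzOnWith).absolutelyContinuousOnInterval
      have hibp := hPac.integral_mul_deriv_eq_deriv_mul hφac
      rw [hφ0, hφT] at hibp
      have e1 : ∫ x in (0:ℝ)..T, deriv (fun t => ∫ s in (0:ℝ)..t, g s) x * φ x =
          ∫ x in (0:ℝ)..T, g x * φ x := by
        refine intervalIntegral.integral_congr_ae ?_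
        filter_upwards [hg.ae_hasDerivAt_integral] with s hs hs'
        rw [(hs (Set.uIoc_subset_uIcc hs') 0 (by simp)).deriv]
      rw [e1, mul_zero, mul_zero, intervalIntegral.integral_of_le hT,
        intervalIntegral.integral_of_le hT, integral_Ioc_eq_integral_Ioo,
        integral_Ioc_eq_integral_Ioo] at hibp
      have i1 : IntegrableOn (fun t => u t * deriv φ t) (Set.Ioo 0 T) :=
        ((hu.mul hdc.continuousOn).integrableOn_Icc).mono_set Set.Ioo_subset_Icc_self
      have i2 : IntegrableOn (fun t => (∫ s in (0:ℝ)..t, g s) * deriv φ t) (Set.Ioo 0 T) :=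
        ((hPc.mul hdc.continuousOn).integrableOn_Icc).mono_set Set.Ioo_subset_Icc_self
      simp_rw [sub_mul]
      rw [integral_sub i1 i2, H φ hφ hφc hφs, hibp]
      ring)
  have hev : Set.EqOn (fun t => u t - ∫ s in (0:ℝ)..t, g s) (fun _ => c) (Set.Icc 0 T) := by
    refine Set.EqOn.of_subset_closure (s := Set.Ioo 0 T) hcc hc continuousOn_const
      Set.Ioo_subset_Icc_self ?_
    rw [closure_Ioo hT'.ne]
  have h0 := hev ⟨le_rfl, hT⟩
  have h1 := hev ht
  simp only [intervalIntegral.integral_same] at h0 h1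
  linarith

end GraphACE

/-! ### The obstacle set: monotonicity and reflection -/

namespace GraphACE

variable {V : Type*}

/-- Elements of the obstacle sets are monotone: `-𝓑` is a subdifferential. -/
theorem obstacleSet_monotone {u v α β : V → ℝ} (hα : α ∈ obstacleSet u)
    (hβ : β ∈ obstacleSet v) (i : V) : (u i - v i) * (α i - β i) ≤ 0 := by
  obtain ⟨⟨hu0, hu1⟩, a0, am, a1⟩ := hα i
  obtain ⟨⟨hv0, hv1⟩, b0, bm, b1⟩ := hβ i
  -- This is the variational inequality behind `𝓑`. Adding it at `w = v i` to its analogue for `v`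
  -- at `w = u i` gives monotonicity.
  have hA : ∀ w, 0 ≤ w → w ≤ 1 → (u i - w) * α i ≤ 0 := by
    intro w hw0 hw1
    rcases hu0.eq_or_lt with h | h
    · have := a0 h.symm; nlinarith
    · rcases hu1.eq_or_lt with h' | h'
      · have := a1 h'; nlinarith
      · rw [am h h']; simp
  have hB : ∀ w, 0 ≤ w → w ≤ 1 → (v i - w) * β i ≤ 0 := by
    intro w hw0 hw1
    rcases hv0.eq_or_lt with h | h
    · have := b0 h.symm; nlinarith
    · rcases hv1.eq_or_lt with h' | h'
      · have := b1 h'; nlinarith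
      · rw [bm h h']; simp
  nlinarith [hA _ hv0 hv1, hB _ hu0 hu1]

/-- Membership amounts to two sign conditions, each on an open set of values (`u i < 1` and `0 < u
i`). Unlike the three-case definition, these can be tested on nearby approximations. -/
theorem obstacleSet_nonneg {u α : V → ℝ} (hα : α ∈ obstacleSet u) {i : V} (h : u i < 1) :
    0 ≤ α i := by
  obtain ⟨⟨hu0, -⟩, a0, am, -⟩ := hα i
  rcases hu0.eq_or_lt with h' | h'
  · exact a0 h'.symm
  · exact (am h' h).ge

theorem obstacleSet_nonpos {u α : V → ℝ} (hα : α ∈ obstacleSet u) {i : V} (h : 0 < u i) :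
    α i ≤ 0 := by
  obtain ⟨⟨-, hu1⟩, -, am, a1⟩ := hα i
  rcases hu1.eq_or_lt with h' | h'
  · exact a1 h'
  · exact (am h h').le

theorem mem_obstacleSet_of {u α : V → ℝ} (hu : ∀ i, u i ∈ Set.Icc (0 : ℝ) 1)
    (h0 : ∀ i, u i < 1 → 0 ≤ α i) (h1 : ∀ i, 0 < u i → α i ≤ 0) : α ∈ obstacleSet u :=
  fun i => ⟨hu i, fun h => h0 i (by rw [h]; norm_num),
    fun h h' => le_antisymm (h1 i h) (h0 i h'), fun h => h1 i (by rw [h]; norm_num)⟩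

theorem smul_mem_obstacleSet {u α : V → ℝ} {c : ℝ} (hc : 0 ≤ c) (hα : α ∈ obstacleSet u) :
    (fun i => c * α i) ∈ obstacleSet u :=
  mem_obstacleSet_of (fun i => (hα i).1)
    (fun _ h => mul_nonneg hc (obstacleSet_nonneg hα h))
    (fun _ h => mul_nonpos_of_nonneg_of_nonpos hc (obstacleSet_nonpos hα h))

/-- The reflection `u ↦ 1 - u` exchanges the obstacles, so statements about the upper one follow
from those about the lower one. -/
theorem one_sub_mem_obstacleSet {u α : V → ℝ} (hα : α ∈ obstacleSet u) :
    (fun i => -α i) ∈ obstacleSet (fun i => 1 - u i) :=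
  mem_obstacleSet_of (fun i => ⟨by linarith [(hα i).1.2], by linarith [(hα i).1.1]⟩)
    (fun i h => by have := obstacleSet_nonpos hα (i := i) (by linarith); linarith)
    (fun i h => by have := obstacleSet_nonneg hα (i := i) (by linarith); linarith)

/-! ### Obstacle schemes and their comparison -/

/-- `(u_m, b_m)` follow, up to errors of second order in the step `τ`, the time discretization
`u_{m+1} = u_m + τ (G(u_m) + b_{m+1})`, `b_{m+1} ∈ 𝓑(u_{m+1})`, with increments of order `τ` and
bounded `b_m`. -/
structure IsObstacleScheme (G : (V → ℝ) → V → ℝ) (C τ : ℝ) (u b : ℕ → V → ℝ) : Prop where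
  step : ∀ m i, |u (m + 1) i - u m i - τ * (G (u m) i + b (m + 1) i)| ≤ C * τ ^ 2
  mem : ∀ m, b (m + 1) ∈ obstacleSet (u (m + 1))
  mem_Icc : ∀ m i, u m i ∈ Set.Icc (0 : ℝ) 1
  increment : ∀ m i, |u (m + 1) i - u m i| ≤ C * τ
  bound : ∀ m i, |b (m + 1) i| ≤ C

/-- The difference quotients of a discrete trajectory, as a step function of time. -/
noncomputable def stepRate (τ : ℝ) (u : ℕ → V → ℝ) (s : ℝ) : V → ℝ :=
  fun i => (u ⌈s / τ⌉₊ i - u (⌈s / τ⌉₊ - 1) i) / τ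

/-- The piecewise linear interpolant of a discrete trajectory. -/
noncomputable def interpolant (τ : ℝ) (u : ℕ → V → ℝ) (t : ℝ) : V → ℝ :=
  fun i => u 0 i + ∫ s in (0:ℝ)..t, stepRate τ u s i

theorem interpolant_zero (τ : ℝ) (u : ℕ → V → ℝ) : interpolant τ u 0 = u 0 := by
  ext i; simp [interpolant]

theorem interpolant_one_sub (τ : ℝ) (u : ℕ → V → ℝ) (t : ℝ) (i : V) :
    interpolant τ (fun m i => 1 - u m i) t i = 1 - interpolant τ u t i := by
  have : ∀ s, stepRate τ (fun m i => 1 - u m i) s i = -stepRate τ u s i := fun s => by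
    simp only [stepRate]; ring
  simp only [interpolant, this, intervalIntegral.integral_neg]
  ring

namespace IsObstacleScheme

variable {G : (V → ℝ) → V → ℝ} {C τ L : ℝ} {u b : ℕ → V → ℝ}

theorem nonneg (S : IsObstacleScheme G C τ u b) (i : V) : 0 ≤ C :=
  (abs_nonneg _).trans (S.bound 0 i)

theorem one_sub (S : IsObstacleScheme G C τ u b) :
    IsObstacleScheme (fun v i => -G (fun j => 1 - v j) i) C τ (fun m i => 1 - u m i)
      (fun m i => -b m i) where
  step m i := by
    rw [← abs_neg]
    refine le_of_eq_of_le (congrArg abs ?_) (S.step m i)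
    have : (fun j => 1 - (1 - u m j)) = u m := by ext j; ring
    simp only [this]; ring
  mem m := one_sub_mem_obstacleSet (S.mem m)
  mem_Icc m i := ⟨by linarith [(S.mem_Icc m i).2], by linarith [(S.mem_Icc m i).1]⟩
  increment m i := by
    rw [← abs_neg]
    refine le_of_eq_of_le (congrArg abs ?_) (S.increment m i)
    ring
  bound m i := by rw [abs_neg]; exact S.bound m i

theorem abs_stepRate_le (S : IsObstacleScheme G C τ u b) (hτ : 0 < τ) (s : ℝ) (i : V) :
    |stepRate τ u s i| ≤ C := by
  rw [stepRate, abs_div, abs_of_pos hτ, div_le_iff₀ hτ]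
  -- When the ceiling is `0`, truncated subtraction makes both indices `0` and the rate vanishes.
  rcases Nat.eq_zero_or_pos ⌈s / τ⌉₊ with h | h
  · rw [h]; simpa using mul_nonneg (S.nonneg i) hτ.le
  · obtain ⟨m, hm⟩ := Nat.exists_eq_succ_of_ne_zero h.ne'
    rw [hm]; exact S.increment m i

theorem _root_.GraphACE.measurable_stepRate (τ : ℝ) (u : ℕ → V → ℝ) (i : V) :
    Measurable fun s => stepRate τ u s i := by
  have h : Measurable fun m : ℕ => (u m i - u (m - 1) i) / τ := measurable_from_top
  exact h.comp (Nat.measurable_ceil.comp (measurable_id.div_const τ))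

theorem intervalIntegrable_stepRate (S : IsObstacleScheme G C τ u b) (hτ : 0 < τ) (i : V)
    (s t : ℝ) : IntervalIntegrable (fun s => stepRate τ u s i) volume s t := by
  refine (intervalIntegrable_const (c := C)).mono_fun
    (measurable_stepRate τ u i).aestronglyMeasurable (Eventually.of_forall fun r => ?_)
  simp only [Real.norm_eq_abs, abs_of_nonneg (S.nonneg i)]
  exact S.abs_stepRate_le hτ r i

theorem interpolant_sub (S : IsObstacleScheme G C τ u b) (hτ : 0 < τ) (i : V) (s t : ℝ) :
    interpolant τ u t i - interpolant τ u s i = ∫ r in s..t, stepRate τ u r i := by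
  simp only [interpolant]
  rw [add_sub_add_left_eq_sub]
  exact intervalIntegral.integral_interval_sub_left (S.intervalIntegrable_stepRate hτ i _ _)
    (S.intervalIntegrable_stepRate hτ i _ _)

theorem abs_interpolant_sub_le (S : IsObstacleScheme G C τ u b) (hτ : 0 < τ) (i : V) (s t : ℝ) :
    |interpolant τ u t i - interpolant τ u s i| ≤ C * |t - s| := by
  rw [S.interpolant_sub hτ, ← Real.norm_eq_abs]
  exact intervalIntegral.norm_integral_le_of_norm_le_const fun r _ => S.abs_stepRate_le hτ r i

theorem interpolant_natCast_mul (S : IsObstacleScheme G C τ u b) (hτ : 0 < τ) (m : ℕ) (i : V) :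
    interpolant τ u (m * τ) i = u m i := by
  induction m with
  | zero => simp [interpolant_zero]
  | succ m ih =>
    have h := S.interpolant_sub hτ i (m * τ) ((m + 1 : ℕ) * τ)
    have e : ∫ r in (m * τ)..((m + 1 : ℕ) * τ), stepRate τ u r i =
        ∫ r in (m * τ)..((m + 1 : ℕ) * τ), (u (m + 1) i - u m i) / τ := by
      refine intervalIntegral.integral_congr_ae (Eventually.of_forall fun r hr => ?_)
      rw [Set.uIoc_of_le (by push_cast; nlinarith)] at hr
      have hc : ⌈r / τ⌉₊ = m + 1 := by
        rw [Nat.ceil_eq_iff (by omega)]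
        exact ⟨by simpa using (lt_div_iff₀ hτ).2 hr.1, (div_le_iff₀ hτ).2 hr.2⟩
      simp [stepRate, hc]
    rw [e, intervalIntegral.integral_const, ih] at h
    have : (((m + 1 : ℕ) : ℝ) * τ - m * τ) • ((u (m + 1) i - u m i) / τ) = u (m + 1) i - u m i := by
      push_cast; rw [smul_eq_mul]; field_simp; ring
    rw [this] at h
    linarith

theorem abs_interpolant_sub_natCast_le (S : IsObstacleScheme G C τ u b) (hτ : 0 < τ) {t : ℝ}
    {m : ℕ} (h : |t - m * τ| ≤ τ) (i : V) : |interpolant τ u t i - u m i| ≤ C * τ := by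
  rw [← S.interpolant_natCast_mul hτ m i]
  exact (S.abs_interpolant_sub_le hτ i _ _).trans (mul_le_mul_of_nonneg_left h (S.nonneg i))

theorem _root_.GraphACE.abs_sub_ceil_mul_le {τ t : ℝ} (hτ : 0 < τ) (ht : 0 ≤ t) :
    |t - (⌈t / τ⌉₊ : ℝ) * τ| ≤ τ := by
  have h1 : t / τ ≤ ⌈t / τ⌉₊ := Nat.le_ceil _
  have h2 : (⌈t / τ⌉₊ : ℝ) < t / τ + 1 := Nat.ceil_lt_add_one (by positivity)
  have h3 : t / τ * τ = t := by field_simp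
  rw [abs_le]; constructor <;> nlinarith

theorem abs_interpolant_sub_ceil_le (S : IsObstacleScheme G C τ u b) (hτ : 0 < τ) {t : ℝ}
    (ht : 0 ≤ t) (i : V) : |interpolant τ u t i - u ⌈t / τ⌉₊ i| ≤ C * τ :=
  S.abs_interpolant_sub_natCast_le hτ (abs_sub_ceil_mul_le hτ ht) i

/-- A positive time lies in the interval `(mτ, (m+1)τ]` with `m + 1 = ⌈t / τ⌉`. -/
theorem _root_.GraphACE.exists_ceil_div_eq_succ {τ t : ℝ} (hτ : 0 < τ) (ht : 0 < t) :
    ∃ m : ℕ, ⌈t / τ⌉₊ = m + 1 ∧ m * τ < t ∧ t ≤ (m + 1) * τ := by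
  obtain ⟨m, hm⟩ := Nat.exists_eq_succ_of_ne_zero (Nat.ceil_pos.2 (div_pos ht hτ)).ne'
  obtain ⟨h1, h2⟩ := (Nat.ceil_eq_iff (by omega)).1 hm
  refine ⟨m, hm, (lt_div_iff₀ hτ).1 (by simpa using h1), ?_⟩
  simpa using (div_le_iff₀ hτ).1 h2

variable [Fintype V]

/-- The interpolant follows the differential inclusion up to `O(τ)`: `Cτ` comes from the error of
the step, and `LCτ` from moving the argument of `G` from `u m` to the interpolant. -/
theorem abs_stepRate_sub_le (S : IsObstacleScheme G C τ u b) (hτ : 0 < τ) (hL : 0 ≤ L)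
    (hG : ∀ x y i, |G x i - G y i| ≤ L * ‖x - y‖) {t : ℝ} (ht : 0 < t) (i : V) :
    |stepRate τ u t i - (G (interpolant τ u t) i + b ⌈t / τ⌉₊ i)| ≤ (1 + L) * C * τ := by
  obtain ⟨m, hm, h1, h2⟩ := exists_ceil_div_eq_succ hτ ht
  have hC := S.nonneg i
  have hx : ‖u m - interpolant τ u t‖ ≤ C * τ := by
    rw [pi_norm_le_iff_of_nonneg (by positivity)]
    intro j
    rw [Real.norm_eq_abs, Pi.sub_apply, abs_sub_comm]
    exact S.abs_interpolant_sub_natCast_le hτ (by rw [abs_le]; constructor <;> linarith) j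
  have hg := hG (u m) (interpolant τ u t) i
  have hs : |stepRate τ u t i - (G (u m) i + b (m + 1) i)| ≤ C * τ := by
    have e : stepRate τ u t i - (G (u m) i + b (m + 1) i) =
        (u (m + 1) i - u m i - τ * (G (u m) i + b (m + 1) i)) / τ := by
      simp only [stepRate, hm, Nat.add_sub_cancel]; field_simp
    rw [e, abs_div, abs_of_pos hτ, div_le_iff₀ hτ]
    exact (S.step m i).trans_eq (by ring)
  rw [hm]
  calc _ = |(stepRate τ u t i - (G (u m) i + b (m + 1) i)) +
        (G (u m) i - G (interpolant τ u t) i)| := by congr 1; ring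
    _ ≤ C * τ + L * (C * τ) :=
        (abs_add_le _ _).trans (add_le_add hs (hg.trans (mul_le_mul_of_nonneg_left hx hL)))
    _ = _ := by ring

/-- One-sided Lipschitz bound in the Euclidean inner product from a Lipschitz bound in the
maximum norm. -/
theorem _root_.GraphACE.sum_mul_sub_le (hL : 0 ≤ L)
    (hG : ∀ x y i, |G x i - G y i| ≤ L * ‖x - y‖) (x y : V → ℝ) :
    ∑ i, (x i - y i) * (G x i - G y i) ≤ Fintype.card V * L * ∑ i, (x i - y i) ^ 2 := by
  have hn : ‖x - y‖ ^ 2 ≤ ∑ i, (x i - y i) ^ 2 := by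
    have h0 : (0:ℝ) ≤ ∑ i, (x i - y i) ^ 2 := Finset.sum_nonneg fun i _ => sq_nonneg _
    have : ‖x - y‖ ≤ √(∑ i, (x i - y i) ^ 2) := by
      rw [pi_norm_le_iff_of_nonneg (Real.sqrt_nonneg _)]
      intro i
      refine Real.abs_le_sqrt ?_
      exact Finset.single_le_sum (f := fun i => (x i - y i) ^ 2) (fun i _ => sq_nonneg _)
        (Finset.mem_univ i)
    calc ‖x - y‖ ^ 2 ≤ √(∑ i, (x i - y i) ^ 2) ^ 2 := by gcongr
      _ = _ := Real.sq_sqrt h0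
  calc ∑ i, (x i - y i) * (G x i - G y i) ≤ ∑ _i : V, L * ‖x - y‖ ^ 2 := by
        refine Finset.sum_le_sum fun i _ => ?_
        have h1 : |x i - y i| ≤ ‖x - y‖ := norm_le_pi_norm (x - y) i
        calc (x i - y i) * (G x i - G y i) ≤ |x i - y i| * |G x i - G y i| := by
              rw [← abs_mul]; exact le_abs_self _
          _ ≤ ‖x - y‖ * (L * ‖x - y‖) := mul_le_mul h1 (hG x y i) (abs_nonneg _) (norm_nonneg _)
          _ = _ := by ring
    _ = Fintype.card V * L * ‖x - y‖ ^ 2 := by simp; ring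
    _ ≤ _ := by gcongr

/-- Two schemes with the same initial state stay close. -/
theorem sum_sq_interpolant_sub_le {σ : ℝ} {v c : ℕ → V → ℝ} (hL : 0 ≤ L)
    (hG : ∀ x y i, |G x i - G y i| ≤ L * ‖x - y‖) (hC : 0 ≤ C)
    (S : IsObstacleScheme G C τ u b) (S' : IsObstacleScheme G C σ v c)
    (hτ : 0 < τ) (hτ1 : τ ≤ 1) (hσ : 0 < σ) (hσ1 : σ ≤ 1) (h0 : u 0 = v 0) {t T : ℝ}
    (ht : t ∈ Set.Icc 0 T) :
    ∑ i, (interpolant τ u t i - interpolant σ v t i) ^ 2 ≤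
      2 * (Fintype.card V * ((1 + 2 * C) * ((1 + L) * C) + 2 * C ^ 2)) * T *
        Real.exp (2 * (Fintype.card V * L) * T) * (τ + σ) := by
  have key := sum_sq_le_of_inner_deriv_le
    (w := fun t i => interpolant τ u t i - interpolant σ v t i)
    (q := fun t i => stepRate τ u t i - stepRate σ v t i) (T := T) (K := Fintype.card V * L)
    (c := Fintype.card V * ((1 + 2 * C) * ((1 + L) * C) + 2 * C ^ 2) * (τ + σ))
    (by positivity) (by positivity)
    (fun i => (S.intervalIntegrable_stepRate hτ i _ _).sub
      (S'.intervalIntegrable_stepRate hσ i _ _))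
    (fun s _ i => by
      rw [intervalIntegral.integral_sub (S.intervalIntegrable_stepRate hτ i _ _)
        (S'.intervalIntegrable_stepRate hσ i _ _)]
      simp only [interpolant, h0]; ring)
    (Eventually.of_forall fun s hs => ?_) t ht
  · refine key.trans_eq (by ring)
  have hGs := sum_mul_sub_le hL hG (interpolant τ u s) (interpolant σ v s)
  have hterm : ∀ i, (interpolant τ u s i - interpolant σ v s i) *
      (stepRate τ u s i - stepRate σ v s i) ≤
      (interpolant τ u s i - interpolant σ v s i) *
        (G (interpolant τ u s) i - G (interpolant σ v s) i) +
      ((1 + 2 * C) * ((1 + L) * C) + 2 * C ^ 2) * (τ + σ) := by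
    intro i
    have a1 := S.abs_stepRate_sub_le hτ hL hG hs.1 i
    have a2 := S'.abs_stepRate_sub_le hσ hL hG hs.1 i
    have a3 := S.abs_interpolant_sub_ceil_le hτ hs.1.le i
    have a4 := S'.abs_interpolant_sub_ceil_le hσ hs.1.le i
    obtain ⟨m, hm, -, -⟩ := exists_ceil_div_eq_succ hτ hs.1
    obtain ⟨k, hk, -, -⟩ := exists_ceil_div_eq_succ hσ hs.1
    rw [hm] at a1 a3
    rw [hk] at a2 a4
    have a5 := obstacleSet_monotone (S.mem m) (S'.mem k) i
    have a6 := S.bound m i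
    have a7 := S'.bound k i
    have a8 := S.mem_Icc (m + 1) i
    have a9 := S'.mem_Icc (k + 1) i
    set x := interpolant τ u s i
    set y := interpolant σ v s i
    set p := stepRate τ u s i
    set q := stepRate σ v s i
    set g := G (interpolant τ u s) i
    set g' := G (interpolant σ v s) i
    set β := b (m + 1) i
    set β' := c (k + 1) i
    set U := u (m + 1) i
    set W := v (k + 1) i
    -- Monotonicity holds only at the grid values `U`, `W`, where the multipliers live. The last two
    -- terms are the price of passing to the interpolants `x`, `y` and the consistency error; both
    -- are `O(τ + σ)`.
    have e : (x - y) * (p - q) = (x - y) * (g - g') + (U - W) * (β - β') +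
        ((x - U) - (y - W)) * (β - β') + (x - y) * ((p - (g + β)) - (q - (g' + β'))) := by ring
    have b1 : |(x - U) - (y - W)| ≤ C * (τ + σ) :=
      (abs_sub _ _).trans ((add_le_add a3 a4).trans_eq (by ring))
    have b2 : |β - β'| ≤ 2 * C := (abs_sub _ _).trans ((add_le_add a6 a7).trans_eq (by ring))
    have b3 : |(p - (g + β)) - (q - (g' + β'))| ≤ (1 + L) * C * (τ + σ) :=
      (abs_sub _ _).trans ((add_le_add a1 a2).trans_eq (by ring))
    have b4 : |x - y| ≤ 1 + 2 * C := by
      have hCτ : C * τ ≤ C := mul_le_of_le_one_right hC hτ1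
      have hCσ : C * σ ≤ C := mul_le_of_le_one_right hC hσ1
      have c1 := abs_le.1 a3
      have c2 := abs_le.1 a4
      rw [abs_le]
      constructor <;> linarith [a8.1, a8.2, a9.1, a9.2, c1.1, c1.2, c2.1, c2.2]
    have d1 : ((x - U) - (y - W)) * (β - β') ≤ C * (τ + σ) * (2 * C) :=
      (le_abs_self _).trans (by rw [abs_mul]; gcongr)
    have d2 : (x - y) * ((p - (g + β)) - (q - (g' + β'))) ≤
        (1 + 2 * C) * ((1 + L) * C * (τ + σ)) :=
      (le_abs_self _).trans (by rw [abs_mul]; gcongr)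
    rw [e]
    nlinarith
  refine (Finset.sum_le_sum fun i _ => hterm i).trans ?_
  rw [Finset.sum_add_distrib]
  simp only [Finset.sum_const, Finset.card_univ, nsmul_eq_mul]
  linarith

end IsObstacleScheme

end GraphACE

/-! ### The limit trajectory and one-sided bounds on its velocity -/

namespace GraphACE

variable {V : Type*}

/-- If schemes with initial state `u₀` exist for small steps, their interpolants converge to a
limit trajectory, locally uniformly and at rate `√τ`. -/
theorem exists_limit_of_obstacleSchemes [Fintype V] {G : (V → ℝ) → V → ℝ} {C L : ℝ} {u₀ : V → ℝ}
    (hL : 0 ≤ L) (hG : ∀ x y i, |G x i - G y i| ≤ L * ‖x - y‖) (hC : 0 ≤ C)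
    {τ₀ : ℝ} (hτ₀ : 0 < τ₀)
    (hex : ∀ τ, 0 < τ → τ < τ₀ → ∃ u b, IsObstacleScheme G C τ u b ∧ u 0 = u₀) :
    ∃ uhat : ℝ → V → ℝ, uhat 0 = u₀ ∧ (∀ t i, uhat t i ∈ Set.Icc (0 : ℝ) 1) ∧
      (∀ s t i, |uhat t i - uhat s i| ≤ C * |t - s|) ∧
      ∀ T, 0 ≤ T → ∃ D, 0 ≤ D ∧ ∀ τ u b, 0 < τ → τ ≤ 1 → IsObstacleScheme G C τ u b → u 0 = u₀ →
        ∀ t ∈ Set.Icc 0 T, ∀ i, |interpolant τ u t i - uhat t i| ^ 2 ≤ D * τ := by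
  set D : ℝ → ℝ := fun T => 2 * (Fintype.card V * ((1 + 2 * C) * ((1 + L) * C) + 2 * C ^ 2)) * T *
        Real.exp (2 * (Fintype.card V * L) * T) with hD
  have hD0 : ∀ T, 0 ≤ T → 0 ≤ D T := fun T hT => by positivity
  have hcmp : ∀ T, ∀ τ σ u b v c, 0 < τ → τ ≤ 1 → 0 < σ → σ ≤ 1 →
      IsObstacleScheme G C τ u b → IsObstacleScheme G C σ v c → u 0 = u₀ → v 0 = u₀ →
      ∀ t ∈ Set.Icc 0 T, ∀ i,
        |interpolant τ u t i - interpolant σ v t i| ^ 2 ≤ D T * (τ + σ) := by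
    intro T τ σ u b v c hτ hτ1 hσ hσ1 S S' hu hv t ht i
    rw [sq_abs]
    refine le_trans ?_
      (S.sum_sq_interpolant_sub_le hL hG hC S' hτ hτ1 hσ hσ1 (hu.trans hv.symm) ht)
    exact Finset.single_le_sum
      (f := fun i => (interpolant τ u t i - interpolant σ v t i) ^ 2)
      (fun i _ => sq_nonneg _) (Finset.mem_univ i)
  set h := min (τ₀ / 2) 1 with hh
  have hh0 : 0 < h := lt_min (by positivity) one_pos
  set σ : ℕ → ℝ := fun k => h / (k + 1) with hσdef
  have hσ0 : ∀ k, 0 < σ k := fun k => by positivity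
  have hσh : ∀ k, σ k ≤ h := fun k => div_le_self hh0.le (by linarith [k.cast_nonneg (α := ℝ)])
  have hσ1 : ∀ k, σ k ≤ 1 := fun k => (hσh k).trans (min_le_right _ _)
  have hσlim : Tendsto σ atTop (𝓝 0) := by
    have := (tendsto_one_div_add_atTop_nhds_zero_nat (𝕜 := ℝ)).const_mul h
    simpa [hσdef, div_eq_mul_inv] using this
  have hσanti : ∀ k l, k ≤ l → σ l ≤ σ k := fun k l hkl => by
    have : (k : ℝ) ≤ l := by exact_mod_cast hkl
    simp only [hσdef]; gcongr
  choose U B hS hU using fun k => hex (σ k) (hσ0 k)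
    ((hσh k).trans_lt ((min_le_left _ _).trans_lt (by linarith)))
  -- Negative times are frozen at `0`, which makes the limit `[0,1]`-valued and Lipschitz on the
  -- whole line.
  have hlim : ∀ (t : ℝ) (i : V), ∃ l,
      Tendsto (fun k => interpolant (σ k) (U k) (max t 0) i) atTop (𝓝 l) := by
    intro t i
    refine cauchySeq_tendsto_of_complete (cauchySeq_of_le_tendsto_0
      (fun N => √(D (max t 0) * (σ N + σ N))) (fun n m N hn hm => ?_) ?_)
    · rw [Real.dist_eq]
      refine Real.le_sqrt_of_sq_le ?_
      refine (hcmp _ _ _ _ _ _ _ (hσ0 n) (hσ1 n) (hσ0 m) (hσ1 m) (hS n) (hS m) (hU n) (hU m) _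
        ⟨le_max_right _ _, le_rfl⟩ i).trans ?_
      exact mul_le_mul_of_nonneg_left (add_le_add (hσanti _ _ hn) (hσanti _ _ hm))
        (hD0 _ (le_max_right _ _))
    · have := ((hσlim.add hσlim).const_mul (D (max t 0))).sqrt
      simpa using this
  choose uhat huhat using hlim
  refine ⟨uhat, ?_, ?_, ?_, ?_⟩
  · ext i
    refine tendsto_nhds_unique (huhat 0 i) ?_
    simp only [max_self, interpolant_zero, hU]
    exact tendsto_const_nhds
  · intro t i
    have hCσ : Tendsto (fun k => C * σ k) atTop (𝓝 0) := by simpa using hσlim.const_mul C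
    have hb := fun k => abs_le.1 ((hS k).abs_interpolant_sub_ceil_le (hσ0 k) (le_max_right t 0) i)
    have hm := fun k => (hS k).mem_Icc ⌈max t 0 / σ k⌉₊ i
    constructor
    · refine ge_of_tendsto (by simpa using (huhat t i).add hCσ)
        (Eventually.of_forall fun k => ?_)
      linarith [(hb k).1, (hm k).1]
    · refine le_of_tendsto (by simpa using (huhat t i).sub hCσ)
        (Eventually.of_forall fun k => ?_)
      linarith [(hb k).2, (hm k).2]
  · intro s t i
    refine (le_of_tendsto ((huhat t i).sub (huhat s i)).abs
      (Eventually.of_forall fun k => (hS k).abs_interpolant_sub_le (hσ0 k) i _ _)).trans ?_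
    exact mul_le_mul_of_nonneg_left (abs_max_sub_max_le_abs t s 0) hC
  · intro T hT
    -- Compare an arbitrary scheme with the reference schemes of step `σ k` and let `k → ∞`.
    refine ⟨D T, hD0 T hT, fun τ u b hτ hτ1 S hu t ht i => ?_⟩
    have h1 := huhat t i
    rw [max_eq_left ht.1] at h1
    have h2 : Tendsto (fun k => D T * (τ + σ k)) atTop (𝓝 (D T * τ)) := by
      simpa using (hσlim.const_add τ).const_mul (D T)
    exact le_of_tendsto_of_tendsto' ((tendsto_const_nhds.sub h1).abs.pow 2) h2
      fun k => hcmp T _ _ _ _ _ _ hτ hτ1 (hσ0 k) (hσ1 k) S (hS k) hu (hU k) t ht i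

/-- `uhat` is the locally uniform limit of a sequence of schemes with steps tending to `0`. -/
structure IsSchemeLimit (G : (V → ℝ) → V → ℝ) (C : ℝ) (τ : ℕ → ℝ) (u b : ℕ → ℕ → V → ℝ)
    (uhat : ℝ → V → ℝ) : Prop where
  pos : ∀ n, 0 < τ n
  tendsto_step : Tendsto τ atTop (𝓝 0)
  scheme : ∀ n, IsObstacleScheme G C (τ n) (u n) (b n)
  uniform : ∀ T, ∀ ρ, 0 < ρ → ∀ᶠ n in atTop, ∀ t ∈ Set.Icc 0 T, ∀ i,
    |interpolant (τ n) (u n) t i - uhat t i| ≤ ρ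
  continuous : Continuous uhat

namespace IsSchemeLimit

variable {G : (V → ℝ) → V → ℝ} {C L : ℝ} {τ : ℕ → ℝ} {u b : ℕ → ℕ → V → ℝ} {uhat : ℝ → V → ℝ}

theorem one_sub (H : IsSchemeLimit G C τ u b uhat) :
    IsSchemeLimit (fun v i => -G (fun j => 1 - v j) i) C τ (fun n m i => 1 - u n m i)
      (fun n m i => -b n m i) (fun t i => 1 - uhat t i) where
  pos := H.pos
  tendsto_step := H.tendsto_step
  scheme n := (H.scheme n).one_sub
  uniform T ρ hρ := by
    filter_upwards [H.uniform T ρ hρ] with n hn t ht i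
    rw [interpolant_one_sub, ← abs_neg]
    refine le_of_eq_of_le (congrArg abs ?_) (hn t ht i)
    ring
  continuous := continuous_pi fun i => continuous_const.sub ((continuous_apply i).comp H.continuous)

theorem tendsto_interpolant (H : IsSchemeLimit G C τ u b uhat) {t : ℝ} (ht : 0 ≤ t) (i : V) :
    Tendsto (fun n => interpolant (τ n) (u n) t i) atTop (𝓝 (uhat t i)) := by
  rw [Metric.tendsto_nhds]
  intro ρ hρ
  filter_upwards [H.uniform t (ρ / 2) (by positivity)] with n hn
  rw [Real.dist_eq]
  linarith [hn t ⟨ht, le_rfl⟩ i]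

theorem tendsto_const_mul_step (H : IsSchemeLimit G C τ u b uhat) (c : ℝ) :
    Tendsto (fun n => c * τ n) atTop (𝓝 0) := by
  simpa using H.tendsto_step.const_mul c

/-- The grid index may be any one within a step of `t`: both ends of the step containing `t` are
needed for the multipliers. -/
theorem tendsto_of_abs_le (H : IsSchemeLimit G C τ u b uhat) {t : ℝ} (ht : 0 ≤ t) {k : ℕ → ℕ}
    (hk : ∀ n, |t - k n * τ n| ≤ τ n) :
    Tendsto (fun n => u n (k n)) atTop (𝓝 (uhat t)) := by
  rw [tendsto_pi_nhds]
  intro i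
  have h1 : Tendsto (fun n => interpolant (τ n) (u n) t i - u n (k n) i) atTop (𝓝 0) :=
    squeeze_zero_norm (fun n => (H.scheme n).abs_interpolant_sub_natCast_le (H.pos n) (hk n) i)
      (H.tendsto_const_mul_step C)
  simpa using (H.tendsto_interpolant ht i).sub h1

theorem tendsto_ceil (H : IsSchemeLimit G C τ u b uhat) {t : ℝ} (ht : 0 ≤ t) :
    Tendsto (fun n => u n ⌈t / τ n⌉₊) atTop (𝓝 (uhat t)) :=
  H.tendsto_of_abs_le ht fun n => abs_sub_ceil_mul_le (H.pos n) ht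

variable [Fintype V]

theorem _root_.GraphACE.continuous_of_abs_sub_le (hL : 0 ≤ L)
    (hG : ∀ x y i, |G x i - G y i| ≤ L * ‖x - y‖) (i : V) : Continuous fun x => G x i := by
  refine (LipschitzWith.of_dist_le_mul (K := ⟨L, hL⟩) fun x y => ?_).continuous
  rw [Real.dist_eq, dist_eq_norm]
  exact hG x y i

theorem _root_.GraphACE.one_sub_lipschitz (hG : ∀ x y i, |G x i - G y i| ≤ L * ‖x - y‖) :
    ∀ x y i, |(fun (v : V → ℝ) i => -G (fun j => 1 - v j) i) x i -
      (fun (v : V → ℝ) i => -G (fun j => 1 - v j) i) y i| ≤ L * ‖x - y‖ := by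
  intro x y i
  have h := hG (fun j => 1 - y j) (fun j => 1 - x j) i
  have e : (fun j => 1 - y j) - (fun j => 1 - x j) = x - y := by
    ext j; simp
  rw [e] at h
  refine le_of_eq_of_le (congrArg abs ?_) h
  ring

/-- Below the upper obstacle the limit grows at least at the rate of the unconstrained flow. -/
theorem le_of_hasDerivAt (H : IsSchemeLimit G C τ u b uhat) (hL : 0 ≤ L)
    (hG : ∀ x y i, |G x i - G y i| ≤ L * ‖x - y‖) {t d : ℝ} (ht : 0 ≤ t) {i : V}
    (h1 : uhat t i < 1) (hd : HasDerivAt (fun s => uhat s i) d t) : G (uhat t) i ≤ d := by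
  by_contra! hcon
  set g := G (uhat t) i with hg
  -- Of the gap `4η`, one `η` each is spent on the variation of `G` along the limit, on the distance
  -- to the interpolant and on the consistency error. The slopes stay above `g - 3η = d + η`, which
  -- exceeds `d`.
  set η := (g - d) / 4 with hη
  have hη0 : 0 < η := by rw [hη]; linarith
  -- With this margin the grid values near `t` stay below `1`, so their multipliers are nonnegative
  -- and can only help.
  set ρ := (1 - uhat t i) / 4 with hρ
  have hρ0 : 0 < ρ := by rw [hρ]; linarith
  have hci : Continuous fun s => uhat s i := (continuous_apply i).comp H.continuous
  have hcG : Continuous fun s => G (uhat s) i :=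
    (continuous_of_abs_sub_le hL hG i).comp H.continuous
  have hev : ∀ᶠ s in 𝓝 t, uhat s i < 1 - 3 * ρ ∧ g - η < G (uhat s) i :=
    (hci.continuousAt.eventually_lt continuousAt_const (by rw [hρ]; linarith)).and
      (continuousAt_const.eventually_lt hcG.continuousAt (by rw [hg]; linarith))
  obtain ⟨δ, hδ, hδ'⟩ := Metric.eventually_nhds_iff.1 hev
  set κ := min ρ (η / (L + 1)) with hκ
  have hκ0 : 0 < κ := lt_min hρ0 (by positivity)
  have hLκ : L * κ ≤ η := by
    have : κ ≤ η / (L + 1) := min_le_right _ _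
    rw [le_div_iff₀ (by positivity)] at this
    nlinarith
  have hslope : ∀ s ∈ Set.Ioo t (t + δ), (g - 3 * η) * (s - t) ≤ uhat s i - uhat t i := by
    intro s hs
    refine ge_of_tendsto ((H.tendsto_interpolant (ht.trans hs.1.le) i).sub
      (H.tendsto_interpolant ht i)) ?_
    filter_upwards [H.uniform (t + δ) κ hκ0,
      (H.tendsto_const_mul_step C).eventually_lt_const hρ0,
      (H.tendsto_const_mul_step ((1 + L) * C)).eventually_lt_const hη0] with n hn1 hn2 hn3
    have S := H.scheme n
    have hτ := H.pos n
    rw [S.interpolant_sub hτ]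
    have hconst : (g - 3 * η) * (s - t) = ∫ _r in t..s, (g - 3 * η) := by
      rw [intervalIntegral.integral_const, smul_eq_mul]; ring
    rw [hconst]
    refine intervalIntegral.integral_mono_on_of_le_Ioo hs.1.le intervalIntegrable_const
      (S.intervalIntegrable_stepRate hτ i _ _) fun r hr => ?_
    have hr0 : 0 < r := ht.trans_lt hr.1
    have hrI : r ∈ Set.Icc 0 (t + δ) := ⟨hr0.le, (hr.2.trans hs.2).le⟩
    obtain ⟨hr1, hr2⟩ := hδ' (y := r) (by
      rw [Real.dist_eq, abs_lt]; constructor <;> linarith [hr.1, hr.2, hs.2])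
    have a1 := abs_le.1 (hn1 r hrI i)
    have a2 := abs_le.1 (S.abs_interpolant_sub_ceil_le hτ hr0.le i)
    have a3 := abs_le.1 (S.abs_stepRate_sub_le hτ hL hG hr0 i)
    obtain ⟨m, hm, -, -⟩ := exists_ceil_div_eq_succ hτ hr0
    have hκρ : κ ≤ ρ := min_le_left _ _
    have hb : 0 ≤ b n ⌈r / τ n⌉₊ i := by
      rw [hm] at a2 ⊢
      exact obstacleSet_nonneg (S.mem m) (by linarith [a1.2, a2.1])
    have hxn : ‖interpolant (τ n) (u n) r - uhat r‖ ≤ κ := by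
      rw [pi_norm_le_iff_of_nonneg hκ0.le]
      exact fun j => hn1 r hrI j
    have a4 := abs_le.1 ((hG (interpolant (τ n) (u n) r) (uhat r) i).trans
      (mul_le_mul_of_nonneg_left hxn hL))
    linarith [a3.1, a4.1]
  have hge : g - 3 * η ≤ d := by
    refine ge_of_tendsto ((hasDerivWithinAt_iff_tendsto_slope' (s := Set.Ioi t)
      (by simp)).1 hd.hasDerivWithinAt) ?_
    filter_upwards [Ioo_mem_nhdsGT (show t < t + δ by linarith)] with s hs
    rw [slope_def_field, le_div_iff₀ (by linarith [hs.1])]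
    exact hslope s hs
  rw [hη] at hge
  linarith

theorem ge_of_hasDerivAt (H : IsSchemeLimit G C τ u b uhat) (hL : 0 ≤ L)
    (hG : ∀ x y i, |G x i - G y i| ≤ L * ‖x - y‖) {t d : ℝ} (ht : 0 ≤ t) {i : V}
    (h0 : 0 < uhat t i) (hd : HasDerivAt (fun s => uhat s i) d t) : d ≤ G (uhat t) i := by
  have := H.one_sub.le_of_hasDerivAt hL (one_sub_lipschitz hG) ht (i := i)
    (by simpa using h0) (hd.const_sub 1)
  simp only [sub_sub_cancel] at this
  linarith

end IsSchemeLimit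

end GraphACE

/-! ### Convergence of the multipliers -/

namespace GraphACE

variable {V : Type*}

/-- A trajectory pushed towards the lower obstacle at rate at least `c` decreases linearly until it
reaches the obstacle, and then stays there. -/
theorem IsObstacleScheme.le_max_of_field_le {G : (V → ℝ) → V → ℝ} {C τ c : ℝ}
    {u b : ℕ → V → ℝ} (S : IsObstacleScheme G C τ u b) (hτ : 0 < τ) (hc : 0 < c) {i : V}
    {k₀ k₁ : ℕ} (hG : ∀ k, k₀ ≤ k → k < k₁ → G (u k) i + C * τ ≤ -c) (k : ℕ) (hk : k₀ ≤ k) :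
    k ≤ k₁ → u k i ≤ max 0 (u k₀ i - (k - k₀) * (c * τ)) := by
  induction k, hk using Nat.le_induction with
  | base => intro _; simp
  | succ k hk ih =>
    intro hk1
    have ih' := ih (by omega)
    have hg := hG k hk (by omega)
    have hs := abs_le.1 (S.step k i)
    rcases le_or_gt (u (k + 1) i) 0 with h | h
    · exact h.trans (le_max_left _ _)
    -- Off the lower obstacle the multiplier can only push down, and the term `C * τ` in the
    -- hypothesis absorbs the consistency error.
    have hb := obstacleSet_nonpos (S.mem k) h
    have hstep : u (k + 1) i ≤ u k i - c * τ := by nlinarith [hs.2]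
    have hcτ : 0 < c * τ := by positivity
    rcases le_max_iff.1 ih' with h' | h'
    · linarith
    · refine le_max_of_le_right ?_
      push_cast
      linarith

namespace IsSchemeLimit

variable [Fintype V] {G : (V → ℝ) → V → ℝ} {C L : ℝ} {τ : ℕ → ℝ} {u b : ℕ → ℕ → V → ℝ}
  {uhat : ℝ → V → ℝ}

/-- If the limit touches the lower obstacle with zero velocity where the field points strictly
outwards, then the discrete trajectories have reached the obstacle. -/
theorem eventually_eq_zero (H : IsSchemeLimit G C τ u b uhat) (hL : 0 ≤ L)
    (hG : ∀ x y i, |G x i - G y i| ≤ L * ‖x - y‖) {t : ℝ} (ht : 0 < t) {i : V}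
    (h0 : uhat t i = 0) (hd : HasDerivAt (fun s => uhat s i) 0 t) (hg : G (uhat t) i < 0)
    {m : ℕ → ℕ} (hm : ∀ n, m n * τ n < t ∧ t ≤ (m n + 1) * τ n) :
    ∀ᶠ n in atTop, u n (m n) i = 0 ∧ u n (m n + 1) i = 0 := by
  -- The field is below `-3c` near `t`; losing `c` to the distance from the limit and `c` to the
  -- consistency error leaves a descent rate of at least `c`.
  set c := -G (uhat t) i / 4 with hc
  have hc0 : 0 < c := by rw [hc]; linarith
  have hcG : Continuous fun s => G (uhat s) i :=
    (continuous_of_abs_sub_le hL hG i).comp H.continuous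
  have hev : ∀ᶠ s in 𝓝 t, G (uhat s) i < -(3 * c) ∧ |uhat s i| ≤ c / 4 * |s - t| := by
    refine (hcG.continuousAt.eventually_lt continuousAt_const (by rw [hc]; linarith)).and ?_
    have := (hasDerivAt_iff_isLittleO.1 hd).bound (show 0 < c / 4 by positivity)
    filter_upwards [this] with s hs
    simpa [h0] using hs
  obtain ⟨δ', hδ', hball⟩ := Metric.eventually_nhds_iff.1 hev
  set δ := min (δ' / 2) (t / 2) with hδ
  have hδ0 : 0 < δ := lt_min (by positivity) (by positivity)
  have hδt : δ ≤ t / 2 := min_le_right _ _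
  have hδδ : δ ≤ δ' / 2 := min_le_left _ _
  have hwin : ∀ s, t - δ ≤ s → s ≤ t → G (uhat s) i < -(3 * c) ∧ |uhat s i| ≤ c / 4 * |s - t| :=
    fun s h1 h2 => hball (by rw [Real.dist_eq, abs_lt]; constructor <;> linarith)
  set κ := min (c / (L + 1)) (c * δ / 4) with hκ
  have hκ0 : 0 < κ := lt_min (by positivity) (by positivity)
  have hLκ : L * κ ≤ c := by
    have : κ ≤ c / (L + 1) := min_le_left _ _
    rw [le_div_iff₀ (by positivity)] at this
    nlinarith
  have hκδ : κ ≤ c * δ / 4 := min_le_right _ _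
  filter_upwards [H.uniform t κ hκ0, (H.tendsto_const_mul_step C).eventually_lt_const hc0,
    H.tendsto_step.eventually_lt_const (show 0 < δ / 8 by positivity)] with n hn1 hn2 hn3
  have S := H.scheme n
  have hτ := H.pos n
  obtain ⟨hm1, hm2⟩ := hm n
  have hgrid : ∀ k : ℕ, k * τ n ≤ t → ∀ j, |u n k j - uhat (k * τ n) j| ≤ κ := fun k hk j => by
    rw [← S.interpolant_natCast_mul hτ k j]
    exact hn1 _ ⟨by positivity, hk⟩ j
  have hfield : ∀ k : ℕ, t - δ ≤ k * τ n → k * τ n ≤ t → G (u n k) i + C * τ n ≤ -c := by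
    intro k h1 h2
    have hx : ‖u n k - uhat (k * τ n)‖ ≤ κ := by
      rw [pi_norm_le_iff_of_nonneg hκ0.le]
      exact fun j => hgrid k h2 j
    have a := abs_le.1 ((hG (u n k) (uhat (k * τ n)) i).trans (mul_le_mul_of_nonneg_left hx hL))
    linarith [(hwin _ h1 h2).1, a.2]
  set k₀ := ⌈(t - δ) / τ n⌉₊ with hk₀
  have hk1 : t - δ ≤ k₀ * τ n := (div_le_iff₀ hτ).1 (Nat.le_ceil _)
  have hk2 : k₀ * τ n < t - δ + τ n := by
    have := Nat.ceil_lt_add_one (show 0 ≤ (t - δ) / τ n from div_nonneg (by linarith) hτ.le)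
    have h' := mul_lt_mul_of_pos_right this hτ
    rwa [add_mul, div_mul_cancel₀ _ hτ.ne', one_mul] at h'
  have hk0m : k₀ ≤ m n := by
    have : (k₀ : ℝ) * τ n < (m n : ℝ) * τ n := by linarith
    exact_mod_cast (lt_of_mul_lt_mul_right this hτ.le).le
  have hfield' : ∀ k, k₀ ≤ k → k < m n + 1 → G (u n k) i + C * τ n ≤ -c := by
    intro k hk hk'
    have c1 : (k₀ : ℝ) ≤ k := by exact_mod_cast hk
    have c2 : (k : ℝ) ≤ m n := by exact_mod_cast Nat.lt_succ_iff.1 hk'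
    exact hfield k (by nlinarith) (by nlinarith)
  -- Zero velocity makes the limit at most `cδ/4` near time `t - δ`, and `κ` adds at most as much.
  -- Descending at rate `c` from this height takes time `δ/2`, while at least `δ - 2τ` is available.
  have hstart : u n k₀ i ≤ c * δ / 2 := by
    have a1 := abs_le.1 (hgrid k₀ (by linarith) i)
    have a2 := (hwin (k₀ * τ n) hk1 (by linarith)).2
    have a3 : |(k₀ : ℝ) * τ n - t| ≤ δ := by rw [abs_le]; constructor <;> linarith
    have a4 : c / 4 * |(k₀ : ℝ) * τ n - t| ≤ c / 4 * δ := by gcongr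
    have a5 := le_abs_self (uhat (k₀ * τ n) i)
    linarith [a1.2]
  have hfin : ∀ k, m n ≤ k → k ≤ m n + 1 → u n k i = 0 := by
    intro k hk hk'
    refine le_antisymm ?_ (S.mem_Icc k i).1
    have h1 := S.le_max_of_field_le hτ hc0 hfield' k (hk0m.trans hk) hk'
    have c1 : (m n : ℝ) ≤ k := by exact_mod_cast hk
    have c2 : (δ - 2 * τ n) ≤ (k - k₀) * τ n := by nlinarith
    have c3 : c * (δ / 2) ≤ c * ((k - k₀) * τ n) := mul_le_mul_of_nonneg_left (by linarith) hc0.le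
    refine h1.trans (max_le le_rfl ?_)
    linarith
  exact ⟨hfin _ le_rfl (by omega), hfin _ (by omega) le_rfl⟩

/-- The multiplier is squeezed. From above: it is nonpositive off the obstacle, and on it the step
equation with `u_m ≥ 0` bounds it by `-G(u_m) + Cτ`. From below: if `G` vanishes in the limit, its
sign suffices; if `G < 0`, two consecutive iterates are zero and the step equation determines it up
to `Cτ`. -/
theorem tendsto_multiplier_of_eq_zero (H : IsSchemeLimit G C τ u b uhat) (hL : 0 ≤ L)
    (hG : ∀ x y i, |G x i - G y i| ≤ L * ‖x - y‖) {t : ℝ} (ht : 0 < t) {i : V}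
    (h0 : uhat t i = 0) (hd : HasDerivAt (fun s => uhat s i) 0 t) :
    Tendsto (fun n => b n ⌈t / τ n⌉₊ i) atTop (𝓝 (-G (uhat t) i)) := by
  have hg : G (uhat t) i ≤ 0 := H.le_of_hasDerivAt hL hG ht.le (by rw [h0]; norm_num) hd
  choose m hm using fun n => exists_ceil_div_eq_succ (H.pos n) ht
  simp only [fun n => (hm n).1]
  have hum : Tendsto (fun n => u n (m n)) atTop (𝓝 (uhat t)) :=
    H.tendsto_of_abs_le ht.le fun n => by
      have := (hm n).2
      rw [abs_le]; constructor <;> linarith [H.pos n]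
  have hum1 : Tendsto (fun n => u n (m n + 1)) atTop (𝓝 (uhat t)) := by
    have := H.tendsto_ceil ht.le
    simpa only [fun n => (hm n).1] using this
  have hGm : Tendsto (fun n => G (u n (m n)) i) atTop (𝓝 (G (uhat t) i)) :=
    ((continuous_of_abs_sub_le hL hG i).tendsto _).comp hum
  have hCτ := H.tendsto_const_mul_step C
  have hub : Tendsto (fun n => max 0 (-G (u n (m n)) i + C * τ n)) atTop
      (𝓝 (-G (uhat t) i)) := by
    have := (tendsto_const_nhds (x := (0 : ℝ))).max (hGm.neg.add hCτ)
    rwa [add_zero, max_eq_right (by linarith)] at this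
  have hlt1 : ∀ᶠ n in atTop, u n (m n + 1) i < 1 :=
    ((tendsto_pi_nhds.1 hum1) i).eventually_lt_const (by rw [h0]; norm_num)
  have hupper : ∀ᶠ n in atTop, b n (m n + 1) i ≤ max 0 (-G (u n (m n)) i + C * τ n) := by
    refine Eventually.of_forall fun n => ?_
    have S := H.scheme n
    rcases (S.mem_Icc (m n + 1) i).1.eq_or_lt with h | h
    · refine le_max_of_le_right ?_
      have a1 := (abs_le.1 (S.step (m n) i)).1
      have a2 := (S.mem_Icc (m n) i).1
      have hτ := H.pos n
      rw [← h] at a1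
      have : τ n * b n (m n + 1) i ≤ τ n * (-G (u n (m n)) i + C * τ n) := by nlinarith
      exact le_of_mul_le_mul_left this hτ
    · exact le_max_of_le_left (obstacleSet_nonpos (S.mem _) h)
  rcases hg.eq_or_lt with hg | hg
  · rw [hg, neg_zero] at hub ⊢
    exact tendsto_of_tendsto_of_tendsto_of_le_of_le' tendsto_const_nhds hub
      (hlt1.mono fun n hn => obstacleSet_nonneg ((H.scheme n).mem _) hn) hupper
  · have hlb : Tendsto (fun n => -G (u n (m n)) i - C * τ n) atTop (𝓝 (-G (uhat t) i)) := by
      simpa using hGm.neg.sub hCτ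
    refine tendsto_of_tendsto_of_tendsto_of_le_of_le' hlb hub ?_ hupper
    filter_upwards [H.eventually_eq_zero hL hG ht h0 hd hg fun n => (hm n).2] with n hn
    have a1 := (abs_le.1 ((H.scheme n).step (m n) i)).1
    have a2 := (abs_le.1 ((H.scheme n).step (m n) i)).2
    have hτ := H.pos n
    rw [hn.1, hn.2] at a1 a2
    have : τ n * (-G (u n (m n)) i - C * τ n) ≤ τ n * b n (m n + 1) i := by nlinarith
    exact le_of_mul_le_mul_left this hτ

/-- At a point of differentiability of the limit, the multipliers converge. -/
theorem tendsto_multiplier (H : IsSchemeLimit G C τ u b uhat) (hL : 0 ≤ L)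
    (hG : ∀ x y i, |G x i - G y i| ≤ L * ‖x - y‖) (hI : ∀ t i, uhat t i ∈ Set.Icc (0 : ℝ) 1)
    {t d : ℝ} (ht : 0 < t) {i : V} (hd : HasDerivAt (fun s => uhat s i) d t) :
    Tendsto (fun n => b n ⌈t / τ n⌉₊ i) atTop (𝓝 (d - G (uhat t) i)) := by
  rcases (hI t i).1.eq_or_lt with h0 | h0
  · have hd0 : d = 0 := by
      -- Touching an obstacle is a global extremum of the limit, as its values lie in `[0,1]` at all
      -- real times.
      refine IsLocalMin.hasDerivAt_eq_zero (Eventually.of_forall fun s => ?_) hd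
      simp only [← h0]; exact (hI s i).1
    subst hd0
    rw [zero_sub]
    exact H.tendsto_multiplier_of_eq_zero hL hG ht h0.symm hd
  rcases (hI t i).2.eq_or_lt with h1 | h1
  · have hd0 : d = 0 := by
      refine IsLocalMax.hasDerivAt_eq_zero (Eventually.of_forall fun s => ?_) hd
      simp only [h1]; exact (hI s i).2
    subst hd0
    have := H.one_sub.tendsto_multiplier_of_eq_zero hL (one_sub_lipschitz hG) ht (i := i)
      (by simp [h1]) (by simpa using hd.const_sub 1)
    simpa using this.neg
  · have hdG : d = G (uhat t) i := le_antisymm (H.ge_of_hasDerivAt hL hG ht.le h0 hd)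
      (H.le_of_hasDerivAt hL hG ht.le h1 hd)
    rw [hdG, sub_self]
    refine tendsto_const_nhds.congr' ?_
    have hu := (tendsto_pi_nhds.1 (H.tendsto_ceil ht.le)) i
    filter_upwards [hu.eventually_lt_const h1, hu.eventually_const_lt h0] with n hn1 hn0
    obtain ⟨m, hm, -, -⟩ := exists_ceil_div_eq_succ (H.pos n) ht
    rw [hm] at hn0 hn1 ⊢
    exact le_antisymm (obstacleSet_nonneg ((H.scheme n).mem m) hn1)
      (obstacleSet_nonpos ((H.scheme n).mem m) hn0)

/-- The one-sided velocity bounds are exactly the two sign conditions for `𝓑`; no limit of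
multipliers is taken. -/
theorem deriv_sub_mem_obstacleSet (H : IsSchemeLimit G C τ u b uhat) (hL : 0 ≤ L)
    (hG : ∀ x y i, |G x i - G y i| ≤ L * ‖x - y‖) (hI : ∀ t i, uhat t i ∈ Set.Icc (0 : ℝ) 1)
    {t : ℝ} {d : V → ℝ} (ht : 0 ≤ t) (hd : ∀ i, HasDerivAt (fun s => uhat s i) (d i) t) :
    (fun i => d i - G (uhat t) i) ∈ obstacleSet (uhat t) :=
  mem_obstacleSet_of (hI t)
    (fun i h => sub_nonneg.2 (H.le_of_hasDerivAt hL hG ht h (hd i)))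
    (fun i h => sub_nonpos.2 (H.ge_of_hasDerivAt hL hG ht h (hd i)))

end IsSchemeLimit

end GraphACE

/-! ### Invertibility of `A` and second-order expansion of the diffusion -/

namespace GraphACE

/-- Second order Taylor estimate for the exponential in a Banach algebra. -/
theorem norm_exp_sub_one_sub_le {𝔸 : Type*} [NormedRing 𝔸] [NormOneClass 𝔸] [NormedAlgebra ℝ 𝔸]
    [CompleteSpace 𝔸] (X : 𝔸) :
    ‖NormedSpace.exp X - 1 - X‖ ≤ ‖X‖ ^ 2 * Real.exp ‖X‖ := by
  have hs := NormedSpace.exp_series_hasSum_exp' (𝕂 := ℝ) X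
  have h2 := (hasSum_nat_add_iff' 2).2 hs
  simp only [Finset.sum_range_succ, Finset.sum_range_zero, Nat.factorial, Nat.cast_one, inv_one,
    pow_zero, pow_one, one_smul, zero_add, mul_one, ← sub_sub] at h2
  have hr := (NormedSpace.exp_series_hasSum_exp' (𝕂 := ℝ) ‖X‖).mul_left (‖X‖ ^ 2)
  rw [← Real.exp_eq_exp_ℝ] at hr
  refine h2.norm_le_of_bounded hr fun n => ?_
  rw [norm_smul, norm_inv, Real.norm_natCast, smul_eq_mul]
  have h1 : ((n + 2).factorial : ℝ)⁻¹ ≤ (n.factorial : ℝ)⁻¹ := by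
    gcongr
    omega
  calc ((n + 2).factorial : ℝ)⁻¹ * ‖X ^ (n + 2)‖ ≤ (n.factorial : ℝ)⁻¹ * ‖X‖ ^ (n + 2) := by
        gcongr
        exact norm_pow_le X _
    _ = _ := by ring

variable {V : Type*} [Fintype V] [DecidableEq V]

/-- With a nonzero nonnegative fidelity parameter, the operator `A = Δ + M` is injective. -/
theorem isUnit_det_forcedLaplacian (G : WeightedGraph V) (r : ℝ) {μ : V → ℝ}
    (hμ : ∀ i, 0 ≤ μ i) (hμ0 : μ ≠ 0) : IsUnit (forcedLaplacian G r μ).det := by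
  rw [isUnit_iff_ne_zero]
  intro hdet
  obtain ⟨v, hv0, hv⟩ := Matrix.exists_mulVec_eq_zero_iff.2 hdet
  have hdeg : ∀ i, 0 ≤ G.degree i := fun i => Finset.sum_nonneg fun j _ => G.weight_nonneg i j
  -- The weight `d_i^r` undoes the factor `d_i^{-r}` and makes the Laplacian symmetric. At an
  -- isolated vertex all weights vanish and any positive value will do.
  set p : V → ℝ := fun i => if G.degree i = 0 then 1 else G.degree i ^ r with hp
  have hppos : ∀ i, 0 < p i := fun i => by
    simp only [hp]
    split_ifs with h
    · exact one_pos
    · exact Real.rpow_pos_of_pos ((hdeg i).lt_of_ne' h) r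
  have hpw : ∀ i j, p i * (G.degree i ^ (-r) * G.weight i j) = G.weight i j := fun i j => by
    simp only [hp]
    split_ifs with h
    · have : G.weight i j = 0 :=
        (Finset.sum_eq_zero_iff_of_nonneg fun j _ => G.weight_nonneg i j).1 h j (Finset.mem_univ j)
      rw [this]; ring
    · have hd := (hdeg i).lt_of_ne' h
      rw [← mul_assoc, ← Real.rpow_add hd]; simp
  have hAv : ∀ i, (forcedLaplacian G r μ *ᵥ v) i =
      G.degree i ^ (-r) * ∑ j, G.weight i j * (v i - v j) + μ i * v i := fun i => by
    have e : ∑ j, G.weight i j * (v i - v j) = G.degree i * v i - ∑ j, G.weight i j * v j := by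
      simp only [mul_sub, Finset.sum_sub_distrib, WeightedGraph.degree, Finset.sum_mul]
    rw [e, forcedLaplacian, Matrix.add_mulVec, Pi.add_apply, Matrix.mulVec_diagonal,
      WeightedGraph.laplacian, ← Matrix.mulVec_mulVec, Matrix.mulVec_diagonal, Matrix.sub_mulVec,
      Pi.sub_apply, Matrix.mulVec_diagonal]
    rfl
  -- Pairing `A v = 0` with `p v` gives a vanishing sum of nonnegative terms: `v` is constant along
  -- edges, hence constant by connectedness, and zero where `μ > 0`.
  have henergy : ∑ i, ∑ j, G.weight i j * (v i - v j) ^ 2 + 2 * ∑ i, p i * μ i * v i ^ 2 = 0 := by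
    have h1 : ∑ i, p i * v i * (forcedLaplacian G r μ *ᵥ v) i = 0 := by simp [hv]
    have h2 : ∀ i, p i * v i * (forcedLaplacian G r μ *ᵥ v) i =
        ∑ j, G.weight i j * (v i - v j) * v i + p i * μ i * v i ^ 2 := fun i => by
      rw [hAv, mul_add, Finset.mul_sum, Finset.mul_sum]
      congr 1
      · refine Finset.sum_congr rfl fun j _ => ?_
        calc _ = (p i * (G.degree i ^ (-r) * G.weight i j)) * (v i - v j) * v i := by ring
          _ = _ := by rw [hpw]
      · ring
    simp only [h2, Finset.sum_add_distrib] at h1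
    have h3 : ∑ i, ∑ j, G.weight i j * (v i - v j) * v i =
        ∑ i, ∑ j, G.weight i j * (v j - v i) * v j := by
      rw [Finset.sum_comm]
      refine Finset.sum_congr rfl fun i _ => Finset.sum_congr rfl fun j _ => ?_
      rw [G.weight_symm]
    have h4 : ∑ i, ∑ j, G.weight i j * (v i - v j) ^ 2 =
        ∑ i, ∑ j, G.weight i j * (v i - v j) * v i +
        ∑ i, ∑ j, G.weight i j * (v j - v i) * v j := by
      simp only [← Finset.sum_add_distrib]
      exact Finset.sum_congr rfl fun i _ => Finset.sum_congr rfl fun j _ => by ring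
    rw [h4, ← h3]
    linarith
  have hw0 : ∀ i, 0 ≤ ∑ j, G.weight i j * (v i - v j) ^ 2 := fun i =>
    Finset.sum_nonneg fun j _ => mul_nonneg (G.weight_nonneg i j) (sq_nonneg _)
  have hm0 : ∀ i, 0 ≤ p i * μ i * v i ^ 2 := fun i =>
    mul_nonneg (mul_nonneg (hppos i).le (hμ i)) (sq_nonneg _)
  have hW : ∑ i, ∑ j, G.weight i j * (v i - v j) ^ 2 = 0 := by
    linarith [Finset.sum_nonneg fun i (_ : i ∈ Finset.univ) => hw0 i,
      Finset.sum_nonneg fun i (_ : i ∈ Finset.univ) => hm0 i]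
  have hM : ∑ i, p i * μ i * v i ^ 2 = 0 := by linarith
  have hadj : ∀ i j, 0 < G.weight i j → v i = v j := fun i j hij => by
    have h1 := (Finset.sum_eq_zero_iff_of_nonneg fun i _ => hw0 i).1 hW i (Finset.mem_univ i)
    have h2 := (Finset.sum_eq_zero_iff_of_nonneg fun j _ =>
      mul_nonneg (G.weight_nonneg i j) (sq_nonneg _)).1 h1 j (Finset.mem_univ j)
    have h3 := (mul_eq_zero.1 h2).resolve_left hij.ne'
    linarith [pow_eq_zero_iff (two_ne_zero) |>.1 h3]
  have hconst : ∀ i j, v i = v j := fun i j => by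
    obtain ⟨w⟩ := G.connected.preconnected i j
    induction w with
    | nil => rfl
    | cons h _ ih =>
      rw [SimpleGraph.fromRel_adj] at h
      rcases h.2 with h' | h'
      · exact (hadj _ _ h').trans ih
      · exact (hadj _ _ h').symm.trans ih
  obtain ⟨k, hk⟩ := Function.ne_iff.1 hμ0
  have hkv : v k = 0 := by
    have := (Finset.sum_eq_zero_iff_of_nonneg fun i _ => hm0 i).1 hM k (Finset.mem_univ k)
    have hpos : 0 < p k * μ k := mul_pos (hppos k) ((hμ k).lt_of_ne' hk)
    exact pow_eq_zero_iff (two_ne_zero) |>.1 ((mul_eq_zero.1 this).resolve_left hpos.ne')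
  exact hv0 (funext fun i => (hconst i k).trans hkv)

theorem norm_le_one_of_mem_Icc {V : Type*} [Fintype V] {u : V → ℝ} (hu : ∀ i, u i ∈ Set.Icc (0 : ℝ) 1) : ‖u‖ ≤ 1 := by
  rw [pi_norm_le_iff_of_nonneg zero_le_one]
  intro i
  rw [Real.norm_eq_abs, abs_of_nonneg (hu i).1]
  exact (hu i).2

open scoped Matrix.Norms.Operator in
theorem exists_abs_mulVec_le {V : Type*} [Fintype V] (A : Matrix V V ℝ) :
    ∃ L, 0 ≤ L ∧ ∀ (x : V → ℝ) i, |(A *ᵥ x) i| ≤ L * ‖x‖ :=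
  ⟨‖A‖, norm_nonneg A, fun x i =>
    (norm_le_pi_norm (A *ᵥ x) i).trans (Matrix.linfty_opNorm_mulVec A x)⟩

open scoped Matrix.Norms.Operator in
/-- The fidelity forced diffusion is consistent with the explicit Euler method to second order. -/
theorem exists_abs_diffusion_sub_le {A : Matrix V V ℝ} (hA : IsUnit A.det) (f : V → ℝ) (ε : ℝ) :
    ∃ K, 0 ≤ K ∧ ∀ t, 0 < t → t < ε → ∀ u : V → ℝ, (∀ i, u i ∈ Set.Icc (0 : ℝ) 1) → ∀ i,
      |diffusion A f t u i - u i - t * (f i - (A *ᵥ u) i)| ≤ K * t ^ 2 := by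
  set E := ‖A‖ ^ 2 * Real.exp (ε * ‖A‖) with hE
  refine ⟨E + ‖A⁻¹‖ * E * ‖f‖, by positivity, fun t ht htε u hu i => ?_⟩
  have : Nonempty V := ⟨i⟩
  set R := NormedSpace.exp (-(t • A)) - 1 - -(t • A) with hR
  have hRn : ‖R‖ ≤ E * t ^ 2 := by
    refine (norm_exp_sub_one_sub_le _).trans ?_
    have hn : ‖-(t • A)‖ = t * ‖A‖ := by
      rw [norm_neg, norm_smul, Real.norm_eq_abs, abs_of_pos ht]
    rw [hn, hE]
    calc (t * ‖A‖) ^ 2 * Real.exp (t * ‖A‖) ≤ (t * ‖A‖) ^ 2 * Real.exp (ε * ‖A‖) := by gcongr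
      _ = _ := by ring
  have hexp : NormedSpace.exp (-(t • A)) = 1 - t • A + R := by rw [hR]; abel
  -- Here `A⁻¹` cancels the first-order term `tA` exactly, so only the second-order remainder `R` is
  -- multiplied by it.
  have hinv : A⁻¹ * (1 - NormedSpace.exp (-(t • A))) = t • (1 : Matrix V V ℝ) - A⁻¹ * R := by
    rw [hexp]
    have : (1 : Matrix V V ℝ) - (1 - t • A + R) = t • A - R := by abel
    rw [this, mul_sub, Matrix.mul_smul, Matrix.nonsing_inv_mul _ hA]
  have hd : diffusion A f t u = u - t • (A *ᵥ u) + R *ᵥ u + (t • f - (A⁻¹ * R) *ᵥ f) := by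
    rw [diffusion, hinv, hexp]
    simp only [Matrix.add_mulVec, Matrix.sub_mulVec, Matrix.smul_mulVec, Matrix.one_mulVec]
  have e : diffusion A f t u i - u i - t * (f i - (A *ᵥ u) i) =
      (R *ᵥ u) i - ((A⁻¹ * R) *ᵥ f) i := by
    rw [hd]
    simp only [Pi.add_apply, Pi.sub_apply, Pi.smul_apply, smul_eq_mul]
    ring
  have h1 : |(R *ᵥ u) i| ≤ E * t ^ 2 := by
    refine (norm_le_pi_norm (R *ᵥ u) i).trans ((Matrix.linfty_opNorm_mulVec R u).trans ?_)
    exact (mul_le_of_le_one_right (norm_nonneg _) (norm_le_one_of_mem_Icc hu)).trans hRn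
  have h2 : |((A⁻¹ * R) *ᵥ f) i| ≤ ‖A⁻¹‖ * (E * t ^ 2) * ‖f‖ := by
    refine (norm_le_pi_norm ((A⁻¹ * R) *ᵥ f) i).trans
      ((Matrix.linfty_opNorm_mulVec (A⁻¹ * R) f).trans ?_)
    gcongr
    exact (norm_mul_le _ _).trans (by gcongr)
  rw [e]
  exact (abs_sub _ _).trans ((add_le_add h1 h2).trans_eq (by ring))

end GraphACE

/-! ### SDIE iterates: existence, uniqueness, and the scheme they form -/

namespace GraphACE

/-- The vector field of the Allen–Cahn flow without obstacles:
`ε du/dt + ε A u - ε f + 𝟏/2 - u = β` says that `du/dt = aceField A f ε u + β / ε`. -/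
noncomputable def aceField {V : Type*} [Fintype V] (A : Matrix V V ℝ) (f : V → ℝ) (ε : ℝ)
    (v : V → ℝ) : V → ℝ :=
  fun i => f i - (A *ᵥ v) i + v i / ε - 1 / (2 * ε)

theorem exists_lipschitz_aceField {V : Type*} [Fintype V] (A : Matrix V V ℝ) (f : V → ℝ) {ε : ℝ}
    (hε : 0 < ε) :
    ∃ L, 0 ≤ L ∧ ∀ x y i, |aceField A f ε x i - aceField A f ε y i| ≤ L * ‖x - y‖ := by
  obtain ⟨K, hK, hA⟩ := exists_abs_mulVec_le A
  refine ⟨K + 1 / ε, by positivity, fun x y i => ?_⟩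
  have e : aceField A f ε x i - aceField A f ε y i =
      (x - y) i / ε - (A *ᵥ (x - y)) i := by
    simp only [aceField, Matrix.mulVec_sub, Pi.sub_apply]; ring
  have h1 : |(x - y) i / ε| ≤ 1 / ε * ‖x - y‖ := by
    rw [abs_div, abs_of_pos hε, div_eq_mul_one_div, mul_comm]
    gcongr
    exact norm_le_pi_norm (x - y) i
  rw [e]
  exact (abs_sub _ _).trans ((add_le_add h1 (hA (x - y) i)).trans_eq (by ring))

variable {V : Type*} [Fintype V] [DecidableEq V]

/-- Each step is a projection: solve without obstacle for `y`, which is possible as `λ < 1`, and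
clamp to `[0,1]`. The multiplier is the clamping correction times `(1-λ)/λ`. -/
theorem exists_isSDIE (A : Matrix V V ℝ) (f : V → ℝ) {ε τ : ℝ} (hτ : 0 < τ) (hτε : τ < ε)
    (u₀ : V → ℝ) : ∃ u β : ℕ → V → ℝ, IsSDIE A f ε τ u₀ u β := by
  have hε : 0 < ε := hτ.trans hτε
  have hl0 : 0 < τ / ε := div_pos hτ hε
  have hl1 : 0 < 1 - τ / ε := sub_pos.2 ((div_lt_one hε).2 hτε)
  set y : (V → ℝ) → V → ℝ := fun v i => (diffusion A f τ v i - (τ / ε) / 2) / (1 - τ / ε) with hy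
  set next : (V → ℝ) → V → ℝ := fun v i => max 0 (min 1 (y v i)) with hnext
  set u : ℕ → V → ℝ := fun m => Nat.rec u₀ (fun _ v => next v) m with hu
  have hus : ∀ m, u (m + 1) = next (u m) := fun m => rfl
  have hyd : ∀ v i, (1 - τ / ε) * y v i = diffusion A f τ v i - (τ / ε) / 2 := fun v i => by
    simp only [hy]
    rw [mul_comm, div_mul_cancel₀ _ hl1.ne']
  refine ⟨u, fun m i => (1 - τ / ε) / (τ / ε) * (u m i - y (u (m - 1)) i), rfl, fun m i => ?_,
    fun m => ?_⟩
  · simp only [Nat.add_sub_cancel]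
    have h := hyd (u m) i
    have e : τ / ε * ((1 - τ / ε) / (τ / ε) * (u (m + 1) i - y (u m) i)) =
        (1 - τ / ε) * u (m + 1) i - (1 - τ / ε) * y (u m) i := by
      field_simp
    rw [e, h]; ring
  · simp only [Nat.add_sub_cancel]
    have hc : 0 ≤ (1 - τ / ε) / (τ / ε) := by positivity
    refine smul_mem_obstacleSet (α := fun i => u (m + 1) i - y (u m) i) hc
      (mem_obstacleSet_of (fun i => ?_) (fun i h => ?_) fun i h => ?_)
    · rw [hus]
      exact ⟨le_max_left _ _, max_le zero_le_one (min_le_left _ _)⟩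
    · rw [hus] at h ⊢
      simp only [hnext] at h ⊢
      have h1 : min 1 (y (u m) i) < 1 := (le_max_right _ _).trans_lt h
      have h2 : y (u m) i < 1 := by
        by_contra hcon
        rw [min_eq_left (not_lt.1 hcon)] at h1
        exact lt_irrefl _ h1
      rw [min_eq_right h2.le]
      linarith [le_max_right 0 (y (u m) i)]
    · rw [hus] at h ⊢
      simp only [hnext] at h ⊢
      have h1 : 0 < min 1 (y (u m) i) := (lt_max_iff.1 h).resolve_left (lt_irrefl _)
      rw [max_eq_right h1.le]
      linarith [min_le_right 1 (y (u m) i)]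

/-- By monotonicity `(1-λ)(δu)² = λ δu δβ ≤ 0` for the difference of two steps from the same state;
then `λ ≠ 0` determines the multiplier. -/
theorem IsSDIE.unique {A : Matrix V V ℝ} {f : V → ℝ} {ε τ : ℝ} (hτ : 0 < τ) (hτε : τ < ε)
    {u₀ : V → ℝ} {u β u' β' : ℕ → V → ℝ} (S : IsSDIE A f ε τ u₀ u β)
    (S' : IsSDIE A f ε τ u₀ u' β') : u' = u ∧ ∀ m, β' (m + 1) = β (m + 1) := by
  have hε : 0 < ε := hτ.trans hτε
  have hl0 : 0 < τ / ε := div_pos hτ hε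
  have hl1 : 0 < 1 - τ / ε := sub_pos.2 ((div_lt_one hε).2 hτε)
  have hu : ∀ m, u' m = u m := by
    intro m
    induction m with
    | zero => rw [S.init, S'.init]
    | succ m ih =>
      ext i
      have h1 := S.step m i
      have h2 := S'.step m i
      rw [ih] at h2
      have hm := obstacleSet_monotone (S'.mem m) (S.mem m) i
      have h3 : (1 - τ / ε) * (u' (m + 1) i - u (m + 1) i) =
          (τ / ε) * (β' (m + 1) i - β (m + 1) i) := by linarith
      have h4 : (1 - τ / ε) * (u' (m + 1) i - u (m + 1) i) ^ 2 ≤ 0 := by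
        calc _ = (u' (m + 1) i - u (m + 1) i) *
              ((1 - τ / ε) * (u' (m + 1) i - u (m + 1) i)) := by ring
          _ = (τ / ε) * ((u' (m + 1) i - u (m + 1) i) * (β' (m + 1) i - β (m + 1) i)) := by
              rw [h3]; ring
          _ ≤ 0 := mul_nonpos_of_nonneg_of_nonpos hl0.le hm
      have h5 : (u' (m + 1) i - u (m + 1) i) ^ 2 = 0 :=
        le_antisymm (nonpos_of_mul_nonpos_right h4 hl1) (sq_nonneg _)
      linarith [pow_eq_zero_iff (two_ne_zero) |>.1 h5]
  refine ⟨funext hu, fun m => funext fun i => ?_⟩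
  have h1 := S.step m i
  have h2 := S'.step m i
  rw [hu, hu] at h2
  exact mul_left_cancel₀ hl0.ne' (h2.symm.trans h1)

theorem IsSDIE.mem_Icc {A : Matrix V V ℝ} {f : V → ℝ} {ε τ : ℝ} {u₀ : V → ℝ}
    (hu₀ : ∀ i, u₀ i ∈ Set.Icc (0 : ℝ) 1) {u β : ℕ → V → ℝ} (S : IsSDIE A f ε τ u₀ u β) (m : ℕ)
    (i : V) : u m i ∈ Set.Icc (0 : ℝ) 1 := by
  cases m with
  | zero => rw [S.init]; exact hu₀ i
  | succ m => exact (S.mem m i).1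

/-- SDIE iterates are obstacle schemes for the Allen–Cahn field, uniformly in the step. -/
theorem exists_isObstacleScheme_of_isSDIE {A : Matrix V V ℝ} (hA : IsUnit A.det) (f : V → ℝ)
    {ε : ℝ} (hε : 0 < ε) {u₀ : V → ℝ} (hu₀ : ∀ i, u₀ i ∈ Set.Icc (0 : ℝ) 1) :
    ∃ C, 0 ≤ C ∧ ∀ τ u β, 0 < τ → τ < ε → IsSDIE A f ε τ u₀ u β →
      IsObstacleScheme (aceField A f ε) C τ u fun m i => ε⁻¹ * β m i := by
  obtain ⟨K, hK, hKd⟩ := exists_abs_diffusion_sub_le hA f ε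
  obtain ⟨L, hL, hLA⟩ := exists_abs_mulVec_le A
  -- `F` bounds `f - A u` on `[0,1]`-valued states, `B` bounds the multipliers, and `I` bounds the
  -- increments divided by `τ`.
  set F := ‖f‖ + L with hF
  have hF0 : 0 ≤ F := by positivity
  set B := 1 / (2 * ε) + F + K * ε with hB
  set I := 1 / ε + (F + K * ε) + 1 / (2 * ε) + B with hI
  have hB0 : 0 ≤ B := by positivity
  have hI0 : 0 ≤ I := by positivity
  have hIB : B ≤ I := by
    have : 0 ≤ 1 / ε + (F + K * ε) + 1 / (2 * ε) := by positivity
    linarith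
  refine ⟨I + (I / ε + K), by positivity, fun τ u β hτ hτε S => ?_⟩
  have hmem := S.mem_Icc hu₀
  have hdiff : ∀ m i, |diffusion A f τ (u m) i - u m i| ≤ (F + K * ε) * τ := fun m i => by
    have h1 := abs_le.1 (hKd τ hτ hτε (u m) (hmem m) i)
    have h2 : |f i - (A *ᵥ u m) i| ≤ F := by
      refine (abs_sub _ _).trans (add_le_add (norm_le_pi_norm f i) ((hLA _ i).trans ?_))
      exact mul_le_of_le_one_right hL (norm_le_one_of_mem_Icc (hmem m))
    have h3 := abs_le.1 h2
    have h4 : K * τ ^ 2 ≤ K * ε * τ := by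
      rw [sq, ← mul_assoc]; gcongr
    rw [abs_le]
    constructor <;> nlinarith [h1.1, h1.2, h3.1, h3.2]
  have hstep : ∀ m i, (u (m + 1) i - u m i) =
      τ * (u (m + 1) i / ε) + (diffusion A f τ (u m) i - u m i) - τ * (1 / (2 * ε)) +
        τ * (ε⁻¹ * β (m + 1) i) := fun m i => by
    have h1 := S.step m i
    have e : τ * (u (m + 1) i / ε) = τ / ε * u (m + 1) i := by ring
    have e2 : τ * (1 / (2 * ε)) = τ / ε / 2 := by field_simp
    have e3 : τ * (ε⁻¹ * β (m + 1) i) = τ / ε * β (m + 1) i := by ring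
    rw [e, e2, e3]
    linarith
  have hbmem : ∀ m, (fun i => ε⁻¹ * β (m + 1) i) ∈ obstacleSet (u (m + 1)) := fun m =>
    smul_mem_obstacleSet (by positivity) (S.mem m)
  -- A multiplier is negative only at `1` and positive only at `0`. There the increment has the
  -- opposite sign or vanishes, so the multiplier can at most cancel the other terms of the step.
  have hbound : ∀ m i, |ε⁻¹ * β (m + 1) i| ≤ B := fun m i => by
    have h1 := hstep m i
    have h2 := abs_le.1 (hdiff m i)
    have hm := hmem m i
    have hm1 := hmem (m + 1) i
    have hz : 0 ≤ 1 / (2 * ε) := by positivity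
    rw [abs_le]
    constructor
    · rcases hm1.2.eq_or_lt with h | h
      · rw [h] at h1
        refine le_of_mul_le_mul_left ?_ hτ
        have e : τ * (1 / ε) = 2 * (τ * (1 / (2 * ε))) := by field_simp
        rw [hB]
        nlinarith [hm.2, h2.2]
      · exact (neg_nonpos.2 hB0).trans (obstacleSet_nonneg (hbmem m) h)
    · rcases hm1.1.eq_or_lt with h | h
      · rw [← h] at h1
        refine le_of_mul_le_mul_left ?_ hτ
        rw [zero_div, mul_zero] at h1
        rw [hB]
        nlinarith [hm.1, h2.1]
      · exact (obstacleSet_nonpos (hbmem m) h).trans hB0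
  have hinc : ∀ m i, |u (m + 1) i - u m i| ≤ I * τ := fun m i => by
    have h1 := hstep m i
    have h2 := abs_le.1 (hdiff m i)
    have h3 := abs_le.1 (hbound m i)
    have hm1 := hmem (m + 1) i
    have h4 : 0 ≤ u (m + 1) i / ε := div_nonneg hm1.1 hε.le
    have h5 : u (m + 1) i / ε ≤ 1 / ε := by gcongr; exact hm1.2
    have h6 : 0 ≤ 1 / (2 * ε) := by positivity
    have g1 := mul_le_mul_of_nonneg_left h5 hτ.le
    have g2 := mul_nonneg hτ.le h4
    have g3 := mul_le_mul_of_nonneg_left h3.1 hτ.le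
    have g4 := mul_le_mul_of_nonneg_left h3.2 hτ.le
    have g5 := mul_nonneg hτ.le h6
    have g6 : 0 ≤ τ * (1 / ε) := by positivity
    rw [h1, hI, abs_le]
    constructor <;> linarith [h2.1, h2.2]
  refine ⟨fun m i => ?_, hbmem, hmem, fun m i => ?_, fun m i => ?_⟩
  · have h1 := hstep m i
    -- The SDIE treats the term `u/ε` implicitly, the scheme explicitly. The difference is `λ` times
    -- an increment, hence `O(τ²)`.
    have e : u (m + 1) i - u m i - τ * (aceField A f ε (u m) i + ε⁻¹ * β (m + 1) i) =
        τ / ε * (u (m + 1) i - u m i) +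
          (diffusion A f τ (u m) i - u m i - τ * (f i - (A *ᵥ u m) i)) := by
      simp only [aceField]
      linear_combination h1
    have h2 : |τ / ε * (u (m + 1) i - u m i)| ≤ I / ε * τ ^ 2 := by
      rw [abs_mul, abs_of_pos (div_pos hτ hε)]
      calc τ / ε * |u (m + 1) i - u m i| ≤ τ / ε * (I * τ) := by
            gcongr
            exact hinc m i
        _ = _ := by ring
    rw [e]
    refine (abs_add_le _ _).trans ((add_le_add h2 (hKd τ hτ hτε (u m) (hmem m) i)).trans ?_)
    nlinarith [mul_nonneg hI0 (sq_nonneg τ)]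
  · refine (hinc m i).trans ?_
    gcongr
    have : 0 ≤ I / ε + K := by positivity
    linarith
  · refine (hbound m i).trans ?_
    have : 0 ≤ I / ε + K := by positivity
    linarith

end GraphACE

/-! ### Uniqueness of solutions, and `H¹` regularity of Lipschitz trajectories -/

namespace GraphACE

section Uniqueness

variable {V : Type*} [Fintype V]

theorem HasWeakDerivL2.intervalIntegrable {T : ℝ} (hT : 0 ≤ T) {u g : ℝ → V → ℝ}
    (h : HasWeakDerivL2 0 T u g) (i : V) : IntervalIntegrable (fun s => g s i) volume 0 T := by
  rw [intervalIntegrable_iff_integrableOn_Ioo_of_le hT]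
  exact (h.memLp_deriv.integrable (by norm_num)).eval i

theorem HasWeakDerivL2.eq_add_integral {T : ℝ} {u g : ℝ → V → ℝ}
    (h : HasWeakDerivL2 0 T u g) (hu : ContinuousOn u (Set.Ici 0)) {t : ℝ}
    (ht : t ∈ Set.Icc 0 T) (i : V) : u t i = u 0 i + ∫ s in (0:ℝ)..t, g s i :=
  eq_add_integral_of_weak_deriv
    ((continuous_apply i).comp_continuousOn (hu.mono fun _ hs => hs.1))
    (h.intervalIntegrable (ht.1.trans ht.2) i) (fun φ hφ hφc hφs => h.weak φ hφ hφc hφs i) t ht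

/-- Solutions of the double-obstacle Allen–Cahn equation are determined by their initial state. -/
theorem IsACESolution.unique {A : Matrix V V ℝ} {f : V → ℝ} {ε : ℝ} (hε : 0 < ε)
    {u β v ζ : ℝ → V → ℝ} (hu : IsACESolution A f ε (Set.Ici 0) u β)
    (hv : IsACESolution A f ε (Set.Ici 0) v ζ) (h0 : v 0 = u 0) :
    (∀ t, 0 ≤ t → v t = u t) ∧ ∀ᵐ t ∂(volume.restrict (Set.Ici (0 : ℝ))), ζ t = β t := by
  obtain ⟨L, hL, hG⟩ := exists_lipschitz_aceField A f hε
  obtain ⟨u', hu', hue⟩ := hu.equation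
  obtain ⟨v', hv', hve⟩ := hv.equation
  rw [ae_restrict_iff' measurableSet_Ici] at hue hve
  have hdu : ∀ T, 0 ≤ T → HasWeakDerivL2 0 T u u' := fun T hT => hu' 0 (by simp) T hT
  have hdv : ∀ T, 0 ≤ T → HasWeakDerivL2 0 T v v' := fun T hT => hv' 0 (by simp) T hT
  have hq : ∀ T, 0 ≤ T → ∀ i, IntervalIntegrable (fun s => (v' s i - u' s i)) volume 0 T :=
    fun T hT i => ((hdv T hT).intervalIntegrable hT i).sub ((hdu T hT).intervalIntegrable hT i)
  have hw : ∀ t, 0 ≤ t → ∀ i, v t i - u t i = ∫ s in (0:ℝ)..t, (v' s i - u' s i) := by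
    intro t ht i
    rw [intervalIntegral.integral_sub ((hdv t ht).intervalIntegrable ht i)
      ((hdu t ht).intervalIntegrable ht i), (hdv t ht).eq_add_integral hv.continuousOn ⟨ht, le_rfl⟩,
      (hdu t ht).eq_add_integral hu.continuousOn ⟨ht, le_rfl⟩, h0]
    ring
  have huv : ∀ t, 0 ≤ t → v t = u t := by
    intro t ht
    have key := sum_sq_le_of_inner_deriv_le (w := fun t i => v t i - u t i)
      (q := fun s i => v' s i - u' s i) (T := t) (K := Fintype.card V * L) (c := 0)
      (by positivity) le_rfl (hq t ht) (fun s hs => hw s hs.1) (by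
        filter_upwards [hue, hve] with s h1 h2 hs
        obtain ⟨e1, m1⟩ := h1 hs.1.le
        obtain ⟨e2, m2⟩ := h2 hs.1.le
        rw [add_zero]
        refine le_trans (Finset.sum_le_sum fun i _ => ?_) (sum_mul_sub_le hL hG (v s) (u s))
        have hmono := obstacleSet_monotone m2 m1 i
        have hrate : v' s i - u' s i = aceField A f ε (v s) i - aceField A f ε (u s) i +
            ε⁻¹ * (ζ s i - β s i) := by
          rw [← e1 i, ← e2 i]
          simp only [aceField]
          field_simp
          ring
        rw [hrate, mul_add]
        have : (v s i - u s i) * (ε⁻¹ * (ζ s i - β s i)) ≤ 0 := by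
          rw [mul_left_comm]
          exact mul_nonpos_of_nonneg_of_nonpos (by positivity) hmono
        linarith) t ⟨ht, le_rfl⟩
    simp only [mul_zero, zero_mul] at key
    ext i
    have h1 := (Finset.sum_eq_zero_iff_of_nonneg fun i _ => sq_nonneg (v t i - u t i)).1
      (le_antisymm key (Finset.sum_nonneg fun i _ => sq_nonneg _)) i (Finset.mem_univ i)
    linarith [pow_eq_zero_iff (two_ne_zero) |>.1 h1]
  refine ⟨huv, ?_⟩
  -- Once `v = u`, the primitive of `v' - u'` is identically zero on `[0,∞)`, so Lebesgue
  -- differentiation kills `v' - u'` almost everywhere and the equation forces the multipliers to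
  -- agree. The integer `n` exhausts the half-line.
  have hrate : ∀ᵐ s : ℝ, ∀ (n : ℕ) (i : V), s ∈ Set.Ioo (0:ℝ) n → v' s i - u' s i = 0 := by
    rw [ae_all_iff]; intro n
    rw [ae_all_iff]; intro i
    filter_upwards [(hq n n.cast_nonneg i).ae_hasDerivAt_integral] with s hs hsn
    have hn : (0 : ℝ) ≤ n := n.cast_nonneg
    have hd := hs (by rw [Set.uIcc_of_le hn]; exact ⟨hsn.1.le, hsn.2.le⟩) 0 (by simp)
    refine hd.unique (HasDerivAt.congr_of_eventuallyEq (hasDerivAt_const s 0) ?_)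
    filter_upwards [Ioi_mem_nhds hsn.1] with r hr
    rw [← hw r (le_of_lt hr) i, huv r (le_of_lt hr), sub_self]
  rw [ae_restrict_iff' measurableSet_Ici]
  filter_upwards [hue, hve, hrate, Measure.ae_ne volume (0:ℝ)] with s h1 h2 h3 hs0 hs
  ext i
  obtain ⟨n, hn⟩ := exists_nat_gt s
  have h4 := h3 n i ⟨lt_of_le_of_ne hs (Ne.symm hs0), hn⟩
  rw [← (h1 hs).1 i, ← (h2 hs).1 i, huv s hs]
  linear_combination ε * h4

end Uniqueness

/-- A bounded Lipschitz trajectory lies in `H¹` of every bounded interval. -/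
theorem hasWeakDerivL2_of_lipschitzWith {V : Type*} [Fintype V] {C : NNReal} {u : ℝ → V → ℝ}
    (hu : LipschitzWith C u) {B : ℝ} (hB : ∀ t, ‖u t‖ ≤ B) (a b : ℝ) :
    HasWeakDerivL2 a b u (deriv u) where
  memLp := MemLp.of_bound hu.continuous.aestronglyMeasurable B (Eventually.of_forall hB)
  memLp_deriv := MemLp.of_bound (measurable_deriv u).aestronglyMeasurable C
    (Eventually.of_forall fun _ => norm_deriv_le_of_lipschitz hu)
  weak φ hφ hφc hφs i := by
    rcases le_or_gt b a with hab | hab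
    · simp [Set.Ioo_eq_empty (not_lt.2 hab)]
    have hφa : φ a = 0 := image_eq_zero_of_notMem_tsupport fun h' => lt_irrefl _ (hφs h').1
    have hφb : φ b = 0 := image_eq_zero_of_notMem_tsupport fun h' => lt_irrefl _ (hφs h').2
    have hui : LipschitzWith C fun t => u t i :=
      LipschitzWith.of_dist_le_mul fun s t => (dist_le_pi_dist (u s) (u t) i).trans
        (hu.dist_le_mul s t)
    obtain ⟨D, hD⟩ := (hφ.of_le (by simp : (1 : WithTop ℕ∞) ≤ ∞)).lipschitzWith_of_hasCompactSupport
      hφc (by simp)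
    have hibp := (hui.lipschitzOnWith (s := Set.uIcc a b)).absolutelyContinuousOnInterval
      |>.integral_mul_deriv_eq_deriv_mul
        (hD.lipschitzOnWith (s := Set.uIcc a b)).absolutelyContinuousOnInterval
    rw [hφa, hφb, mul_zero, mul_zero, sub_zero, zero_sub, intervalIntegral.integral_of_le hab.le,
      intervalIntegral.integral_of_le hab.le, integral_Ioc_eq_integral_Ioo,
      integral_Ioc_eq_integral_Ioo] at hibp
    rw [hibp]
    congr 1
    refine integral_congr_ae (ae_restrict_of_ae ?_)
    filter_upwards [hu.ae_differentiableAt_real] with t ht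
    rw [(hasDerivAt_pi.1 ht.hasDerivAt i).deriv]

end GraphACE

/-! ### The theorem -/

theorem theorem2p13 {V : Type*} [Fintype V] [DecidableEq V]
    (G : GraphACE.WeightedGraph V) (r : ℝ) (hr : r ∈ Set.Icc (0 : ℝ) 1)
    (μ : V → ℝ) (hμ : ∀ i, 0 ≤ μ i) (hμ0 : μ ≠ 0)
    (ftilde : V → ℝ) (hftilde : ∀ i, ftilde i ∈ Set.Icc (0 : ℝ) 1)
    (A : Matrix V V ℝ) (hA : A = GraphACE.forcedLaplacian G r μ)
    (f : V → ℝ) (hf : f = GraphACE.forcing μ ftilde)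
    (ε : ℝ) (hε : 0 < ε) (hσ : ¬ Module.End.HasEigenvalue (Matrix.toLin' A) ε⁻¹)
    (u₀ : V → ℝ) (hu₀ : ∀ i, u₀ i ∈ Set.Icc (0 : ℝ) 1) :
    -- for `0 < τ < ε` the scheme determines its iterates `u_m` (`m ≥ 0`) and `β_m` (`m ≥ 1`)
    (∀ τ : ℝ, 0 < τ → τ < ε → ∃ u β : ℕ → V → ℝ, GraphACE.IsSDIE A f ε τ u₀ u β ∧
      ∀ u' β' : ℕ → V → ℝ, GraphACE.IsSDIE A f ε τ u₀ u' β' →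
        u' = u ∧ ∀ m, β' (m + 1) = β (m + 1)) ∧
    -- there is a solution `(uhat, γ)` of the double-obstacle ACE on `[0, ∞)` starting at `u₀`
    ∃ uhat γ : ℝ → V → ℝ,
      GraphACE.IsACESolution A f ε (Set.Ici 0) uhat γ ∧ uhat 0 = u₀ ∧
      -- and it is the only one
      (∀ v ζ : ℝ → V → ℝ, GraphACE.IsACESolution A f ε (Set.Ici 0) v ζ → v 0 = u₀ →
        (∀ t, 0 ≤ t → v t = uhat t) ∧ ∀ᵐ t ∂(volume.restrict (Set.Ici (0 : ℝ))), ζ t = γ t) ∧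
      -- convergence of the iterates and of Cesàro averages along a subsequence
      (∀ τ : ℕ → ℝ, (∀ n, 0 < τ n) → Tendsto τ atTop (𝓝 0) →
        ∃ κ : ℕ → ℕ, StrictMono κ ∧ (∀ n, τ (κ n) < ε) ∧
          ∀ u β : ℕ → ℕ → V → ℝ,
            (∀ n, GraphACE.IsSDIE A f ε (τ (κ n)) u₀ (u n) (β n)) →
            (∀ t : ℝ, 0 ≤ t →
              Tendsto (fun n => u n ⌈t / τ (κ n)⌉₊) atTop (𝓝 (uhat t))) ∧
            ∃ N : ℕ → ℕ, Tendsto N atTop atTop ∧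
              ∀ᵐ t ∂(volume.restrict (Set.Ici (0 : ℝ))),
                Tendsto (fun k => (1 / (N k : ℝ)) •
                    ∑ n ∈ Finset.range (N k), β n ⌈t / τ (κ n)⌉₊) atTop (𝓝 (γ t))) ∧
      -- convergence of the iterates along the whole sequence
      (∀ τ : ℕ → ℝ, (∀ n, 0 < τ n ∧ τ n < ε) → Tendsto τ atTop (𝓝 0) →
        ∀ u β : ℕ → ℕ → V → ℝ, (∀ n, GraphACE.IsSDIE A f ε (τ n) u₀ (u n) (β n)) →
          ∀ t : ℝ, 0 ≤ t → Tendsto (fun n => u n ⌈t / τ n⌉₊) atTop (𝓝 (uhat t))) := by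
  have hdet : IsUnit A.det := hA ▸ GraphACE.isUnit_det_forcedLaplacian G r hμ hμ0
  obtain ⟨L, hL, hG⟩ := GraphACE.exists_lipschitz_aceField A f hε
  obtain ⟨C, hC, hscheme⟩ := GraphACE.exists_isObstacleScheme_of_isSDIE hdet f hε hu₀
  obtain ⟨uhat, hinit, hI, hlip, hrate⟩ := GraphACE.exists_limit_of_obstacleSchemes hL hG hC hε
    (u₀ := u₀) fun τ hτ hτε => by
      obtain ⟨u, β, S⟩ := GraphACE.exists_isSDIE A f hτ hτε u₀
      exact ⟨u, _, hscheme τ u β hτ hτε S, S.init⟩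
  have hLip : LipschitzWith ⟨C, hC⟩ uhat := LipschitzWith.of_dist_le_mul fun s t => by
    rw [dist_pi_le_iff (by positivity)]
    exact fun i => by rw [Real.dist_eq, Real.dist_eq]; exact hlip t s i
  have hlimit : ∀ (τ : ℕ → ℝ) (u β : ℕ → ℕ → V → ℝ), (∀ n, 0 < τ n ∧ τ n < ε) →
      Tendsto τ atTop (𝓝 0) → (∀ n, GraphACE.IsSDIE A f ε (τ n) u₀ (u n) (β n)) →
      GraphACE.IsSchemeLimit (GraphACE.aceField A f ε) C τ u (fun n m i => ε⁻¹ * β n m i) uhat :=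
    fun τ u β hτ hlim S =>
    { pos := fun n => (hτ n).1
      tendsto_step := hlim
      scheme := fun n => hscheme _ _ _ (hτ n).1 (hτ n).2 (S n)
      uniform := fun T ρ hρ => by
        obtain ⟨D, -, hD'⟩ := hrate (max T 0) (le_max_right _ _)
        have h1 : Tendsto (fun n => D * τ n) atTop (𝓝 0) := by simpa using hlim.const_mul D
        filter_upwards [h1.eventually_lt_const (show 0 < ρ ^ 2 by positivity),
          hlim.eventually_lt_const one_pos] with n hn1 hn2 t ht i
        exact le_of_sq_le_sq ((hD' _ _ _ (hτ n).1 hn2.le (hscheme _ _ _ (hτ n).1 (hτ n).2 (S n))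
          (S n).init t ⟨ht.1, ht.2.trans (le_max_left _ _)⟩ i).trans hn1.le) hρ.le
      continuous := hLip.continuous }
  have hdiff : ∀ᵐ t ∂(volume.restrict (Set.Ici (0 : ℝ))),
      0 < t ∧ ∀ i, HasDerivAt (fun s => uhat s i) (deriv uhat t i) t := by
    rw [ae_restrict_iff' measurableSet_Ici]
    filter_upwards [hLip.ae_differentiableAt_real, Measure.ae_ne volume (0:ℝ)] with t ht h0 h0'
    exact ⟨lt_of_le_of_ne h0' (Ne.symm h0), hasDerivAt_pi.1 ht.hasDerivAt⟩
  set γ : ℝ → V → ℝ := fun t i => ε * (deriv uhat t i - GraphACE.aceField A f ε (uhat t) i) with hγ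
  have hsol : GraphACE.IsACESolution A f ε (Set.Ici 0) uhat γ := by
    refine ⟨fun t _ => hI t, hLip.continuous.continuousOn, deriv uhat, fun a _ b _ =>
      GraphACE.hasWeakDerivL2_of_lipschitzWith hLip
        (fun t => GraphACE.norm_le_one_of_mem_Icc (hI t)) a b, ?_⟩
    -- Any sequence of steps in `(0, ε)` tending to `0` would serve to exhibit `uhat` as a scheme
    -- limit.
    have hτ : ∀ n : ℕ, 0 < ε / (n + 2) ∧ ε / (n + 2) < ε := fun n =>
      ⟨by positivity, div_lt_self hε (by linarith [n.cast_nonneg (α := ℝ)])⟩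
    have hlim : Tendsto (fun n : ℕ => ε / ((n : ℝ) + 2)) atTop (𝓝 0) :=
      tendsto_const_nhds.div_atTop (tendsto_atTop_add_const_right _ _ tendsto_natCast_atTop_atTop)
    choose u β S using fun n : ℕ => GraphACE.exists_isSDIE A f (hτ n).1 (hτ n).2 u₀
    filter_upwards [hdiff] with t ht
    refine ⟨fun i => ?_, GraphACE.smul_mem_obstacleSet hε.le
      ((hlimit _ u β hτ hlim S).deriv_sub_mem_obstacleSet hL hG hI ht.1.le ht.2)⟩
    simp only [hγ, GraphACE.aceField]
    field_simp
    ring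
  refine ⟨fun τ hτ hτε => ?_, uhat, γ, hsol, hinit, fun v ζ hv hv0 =>
    hsol.unique hε hv (hv0.trans hinit.symm), fun τ hτ hlim => ?_,
    fun τ hτ hlim u β S t ht => (hlimit τ u β hτ hlim S).tendsto_ceil ht⟩
  · obtain ⟨u, β, S⟩ := GraphACE.exists_isSDIE A f hτ hτε u₀
    exact ⟨u, β, S, fun u' β' S' => S.unique hτ hτε S'⟩
  · obtain ⟨N, hN⟩ := eventually_atTop.1 (hlim.eventually_lt_const hε)
    have hκ : Tendsto (fun n => τ (n + N)) atTop (𝓝 0) := (tendsto_add_atTop_iff_nat N).2 hlim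
    have hτ' : ∀ n, 0 < τ (n + N) ∧ τ (n + N) < ε := fun n => ⟨hτ _, hN _ (by omega)⟩
    -- The subsequence is the tail with steps below `ε`.
    refine ⟨fun n => n + N, fun a b hab => by simpa using hab, fun n => (hτ' n).2,
      fun u β S => ?_⟩
    have H := hlimit _ u β hτ' hκ S
    -- The multipliers themselves converge, so `N k = k` works for the averages at almost every
    -- time.
    refine ⟨fun t ht => H.tendsto_ceil ht, id, tendsto_id, ?_⟩
    filter_upwards [hdiff] with t ht
    have hβ : Tendsto (fun n => β n ⌈t / τ (n + N)⌉₊) atTop (𝓝 (γ t)) := by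
      rw [tendsto_pi_nhds]
      intro i
      have := (H.tendsto_multiplier hL hG hI ht.1 (ht.2 i)).const_mul ε
      simpa only [mul_inv_cancel_left₀ hε.ne'] using this
    simpa only [one_div, id] using hβ.cesaro_smul
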